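/- **Theorem (Quotient metric).** Let $d,m,n\ge 0$ be integers, $p>0$, and let $\sigma:\mathbb R\to\mathbb R$ be positively $p$-homogeneous, i.e. $\sigma(ct)=c^p\sigma(t)$ for all $c>0$, $t\in\mathbb R$. For $\theta=((a_i,w_i))_{i=1}^m\in\Theta:=(\mathbb R\times\mathbb R^d)^m$ put $f_\theta(x)=\sum_{i=1}^m a_i\,\sigma(w_i^\top x)$, and for a fixed sample $X=(x_1,\dots,x_n)\in(\mathbb R^d)^n$ put $\Phi_X(\theta)=(f_\theta(x_1),\dots,f_\theta(x_n))\in\mathbb R^n$. Let $G=S_m\ltimes(\mathbb R_{>0})^m$ act on $\Theta$ by permuting the hidden units and by the rescalings $(a_i,w_i)\mapsto(c_i^{-p}a_i,c_iw_i)$. The tangent space of an orbit on which the stabilizers are discrete is $$T_\theta(G\cdot\theta)=\bigl\{\bigl((-p\,\xi_i a_i,\ \xi_i w_i)\bigr)_{i=1}^m:\ \xi\in\mathbb R^m\bigr\}.$$ Let $\Theta_{\mathrm{reg}}\subset\Theta$ be a $G$-invariant embedded smooth submanifold (for instance an open subset) such that * $G$ acts properly and locally freely (i.e. with discrete stabilizers)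 on $\Theta_{\mathrm{reg}}$; * $\Phi_X:\Theta_{\mathrm{reg}}\to\mathbb R^n$ is smooth, and $\ker\bigl(D\Phi_X(\theta):T_\theta\Theta_{\mathrm{reg}}\to\mathbb R^n\bigr)=\mathcal V_\theta:=T_\theta(G\cdot\theta)$ for every $\theta\in\Theta_{\mathrm{reg}}$. Let $q:\Theta_{\mathrm{reg}}\to\mathcal M_{\mathrm{reg}}:=\Theta_{\mathrm{reg}}/G$ be the quotient map, and for $u,v\in T_\theta\Theta_{\mathrm{reg}}$ let $$g_\theta(u,v)=\frac1n\bigl\langle D\Phi_X(\theta)[u],D\Phi_X(\theta)[v]\bigr\rangle_{\mathbb R^n}$$ (read as $0$ when $n=0$). Then: 1. $g$ is a smooth symmetric bilinear form on $T\Theta_{\mathrm{reg}}$, and it is $G$-invariant: $g_{\gamma\cdot\theta}(D\alpha_\gamma u,D\alpha_\gamma v)=g_\theta(u,v)$ for all $\gamma\in G$, where $\alpha_\gamma(\theta)=\gamma\cdot\theta$. 2. $\{u: g_\theta(u,v)=0\ \text{for all } v\}=\mathcal V_\theta$ for every $\theta\in\Theta_{\mathrm{reg}}$. 3. For every $\theta\in\Theta_{\mathrm{reg}}$,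 $g_\theta$ is positive definite on every linear complement of $\mathcal V_\theta$ in $T_\theta\Theta_{\mathrm{reg}}$. 4. With the quotient topology, $\mathcal M_{\mathrm{reg}}$ is Hausdorff and second countable and carries a smooth manifold structure for which $q$ is a smooth submersion. For every such structure, and for every smooth subbundle $\mathcal H\subset T\Theta_{\mathrm{reg}}$ with $T_\theta\Theta_{\mathrm{reg}}=\mathcal V_\theta\oplus\mathcal H_\theta$ and $D\alpha_\gamma(\mathcal H_\theta)=\mathcal H_{\gamma\cdot\theta}$ for all $\theta\in\Theta_{\mathrm{reg}}$ and $\gamma\in G$, there is a unique smooth Riemannian metric $\bar g$ on $\mathcal M_{\mathrm{reg}}$ such that $$\bar g_{[\theta]}(Dq_\theta[u],Dq_\theta[v])=g_\theta(u,v)\qquad\text{for all }\theta\in\Theta_{\mathrm{reg}},\ u,v\in\mathcal H_\theta .$$ -/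

import Mathlib

open scoped Manifold ContDiff Topology

noncomputable section

namespace ShallowNet

/-! ### Parameters, network and finite-sample realization map -/

/-- The parameter space `(ℝ × ℝ^d)^m`; a point is a family `i ↦ (a_i, w_i)`. -/
abbrev Params (d m : ℕ) : Type := Fin m → ℝ × EuclideanSpace ℝ (Fin d)

/-- The shallow network `f_θ(x) = ∑ i, a_i σ(⟨w_i, x⟩)`. -/
def network {d m : ℕ} (σ : ℝ → ℝ) (θ : Params d m) (x : EuclideanSpace ℝ (Fin d)) : ℝ :=
  ∑ i, (θ i).1 * σ (inner ℝ (θ i).2 x)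

/-- The finite-sample realization map `Φ_X(θ) = (f_θ(x_1), …, f_θ(x_n))`. -/
def realization {d m n : ℕ} (σ : ℝ → ℝ) (X : Fin n → EuclideanSpace ℝ (Fin d))
    (θ : Params d m) : EuclideanSpace ℝ (Fin n) :=
  WithLp.toLp 2 fun k => network σ θ (X k)

/-- `σ (c t) = c ^ p σ t` for all `c > 0` and all `t`. -/
def IsPosHomogeneous (p : ℝ) (σ : ℝ → ℝ) : Prop :=
  ∀ c : ℝ, 0 < c → ∀ t : ℝ, σ (c * t) = c ^ p * σ t

/-! ### The symmetry group and its action -/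

/-- The group `(ℝ_{>0})^m ⋊ S_m`, where a permutation `π` acts on scalings by
`(π c)_i = c_{π⁻¹ i}`. The degree `p` does not enter the group; it is recorded in the type because
it enters the action on parameters. -/
def SymGroup (_p : ℝ) (m : ℕ) : Type :=
  (Fin m → {c : ℝ // 0 < c}) ⋊[mulAutArrow] Equiv.Perm (Fin m)

namespace SymGroup

variable {p : ℝ} {m : ℕ}

instance : Group (SymGroup p m) :=
  inferInstanceAs (Group ((Fin m → {c : ℝ // 0 < c}) ⋊[mulAutArrow] Equiv.Perm (Fin m)))

/-- The vector of scaling factors of a group element. -/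
def scale (g : SymGroup p m) : Fin m → {c : ℝ // 0 < c} := SemidirectProduct.left g

/-- The permutation part of a group element. -/
def perm (g : SymGroup p m) : Equiv.Perm (Fin m) := SemidirectProduct.right g

/-- The product topology of `(ℝ_{>0})^m` and the discrete finite group `S_m`. -/
instance : TopologicalSpace (SymGroup p m) :=
  TopologicalSpace.induced scale inferInstance ⊓ TopologicalSpace.induced perm ⊥

lemma scale_one (i : Fin m) : ((1 : SymGroup p m).scale i : ℝ) = 1 := rfl

lemma perm_one : (1 : SymGroup p m).perm = 1 := rfl

lemma scale_mul (g h : SymGroup p m) (i : Fin m) :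
    ((g * h).scale i : ℝ) = g.scale i * h.scale (g.perm⁻¹ i) := rfl

lemma perm_mul (g h : SymGroup p m) : (g * h).perm = g.perm * h.perm := rfl

/-- The element `(c, π)` permutes the hidden units by `π` and then rescales the `i`-th unit
`(a, w)` to `(c_i ^ (-p) a, c_i w)`. -/
instance (d : ℕ) : MulAction (SymGroup p m) (Params d m) where
  smul g θ := fun i =>
    ((g.scale i : ℝ) ^ (-p) * (θ (g.perm⁻¹ i)).1, (g.scale i : ℝ) • (θ (g.perm⁻¹ i)).2)
  one_smul θ := by
    funext i
    change (((1 : SymGroup p m).scale i : ℝ) ^ (-p) * _, ((1 : SymGroup p m).scale i : ℝ) • _) = _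
    simp [scale_one, perm_one]
  mul_smul g h θ := by
    funext i
    change (((g * h).scale i : ℝ) ^ (-p) * _, ((g * h).scale i : ℝ) • _) =
      ((g.scale i : ℝ) ^ (-p) * ((h.scale (g.perm⁻¹ i) : ℝ) ^ (-p) * _),
        (g.scale i : ℝ) • ((h.scale (g.perm⁻¹ i) : ℝ) • _))
    rw [scale_mul, perm_mul, Real.mul_rpow (g.scale i).2.le (h.scale _).2.le, mul_assoc, mul_smul,
      mul_inv_rev]
    rfl

lemma smul_apply {d : ℕ} (g : SymGroup p m) (θ : Params d m) (i : Fin m) :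
    (g • θ) i =
      ((g.scale i : ℝ) ^ (-p) * (θ (g.perm⁻¹ i)).1, (g.scale i : ℝ) • (θ (g.perm⁻¹ i)).2) := rfl

/-- The scaling `(exp ξ_1, …, exp ξ_m)` as an element of the symmetry group. -/
def expScale (p : ℝ) {m : ℕ} (ξ : Fin m → ℝ) : SymGroup p m :=
  SemidirectProduct.inl fun i => ⟨Real.exp (ξ i), Real.exp_pos _⟩

end SymGroup

/-! ### Orbit directions and the vertical space -/

/-- The infinitesimal action `ξ ↦ δ_ξ θ = ((-p ξ_i a_i, ξ_i w_i))_i`. -/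
def orbitDirection {d m : ℕ} (p : ℝ) (θ : Params d m) : (Fin m → ℝ) →ₗ[ℝ] Params d m where
  toFun ξ := fun i => (-p * ξ i * (θ i).1, ξ i • (θ i).2)
  map_add' ξ η := by
    funext i
    ext <;> simp <;> ring
  map_smul' c ξ := by
    funext i
    ext <;> simp <;> ring

/-- `δ_ξ θ` is the velocity at `t = 0` of the orbit curve `t ↦ exp(t ξ) • θ`. -/
lemma hasDerivAt_expScale_smul {d m : ℕ} (p : ℝ) (θ : Params d m) (ξ : Fin m → ℝ) :
    HasDerivAt (fun t : ℝ => SymGroup.expScale p (t • ξ) • θ) (orbitDirection p θ ξ) 0 := by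
  rw [hasDerivAt_pi]
  intro i
  have key : (fun t : ℝ => (SymGroup.expScale p (t • ξ) • θ) i) =
      fun t : ℝ => (Real.exp (t * ξ i * -p) * (θ i).1, Real.exp (t * ξ i) • (θ i).2) := by
    funext t
    rw [Real.exp_mul]
    rfl
  rw [key]
  have h0 : HasDerivAt (fun t : ℝ => t * ξ i) (ξ i) 0 := by
    simpa using (hasDerivAt_id (0 : ℝ)).mul_const (ξ i)
  have h1 : HasDerivAt (fun t : ℝ => Real.exp (t * ξ i)) (ξ i) 0 := by
    simpa using h0.exp
  have h2 : HasDerivAt (fun t : ℝ => Real.exp (t * ξ i * -p)) (ξ i * -p) 0 := by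
    simpa using (h0.mul_const (-p)).exp
  have h3 := (h2.mul_const (θ i).1).prodMk (h1.smul_const (θ i).2)
  have h4 : orbitDirection p θ ξ i = (ξ i * -p * (θ i).1, ξ i • (θ i).2) := by
    simp [orbitDirection, mul_comm]
  rw [h4]
  exact h3

/-- The tangent space `T_θ(G·θ)` of the orbit, as a subspace of the parameter space. -/
def orbitTangent {d m : ℕ} (p : ℝ) (θ : Params d m) : Submodule ℝ (Params d m) :=
  LinearMap.range (orbitDirection p θ)

/-- The pullback `(u, v) ↦ ⟨L u, L v⟩` of an inner product along a continuous linear map. -/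
def pullbackInner {E F : Type*} [NormedAddCommGroup E] [NormedSpace ℝ E] [NormedAddCommGroup F]
    [InnerProductSpace ℝ F] (L : E →L[ℝ] F) : E →L[ℝ] E →L[ℝ] ℝ :=
  (innerSL ℝ : F →L[ℝ] F →L[ℝ] ℝ).bilinearComp L L

section Regular

variable {p : ℝ} {d m n : ℕ} (E : Type*) [NormedAddCommGroup E] [NormedSpace ℝ E]
  (S : SubMulAction (SymGroup p m) (Params d m)) [ChartedSpace E S]

/-- The vertical space `V_θ = T_θ(G·θ) ⊆ T_θ S`, for a `G`-invariant submanifold `S` of the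
parameter space: the tangent vectors of `S` which the differential of the inclusion maps to the
tangent space of the orbit. -/
def vertical (θ : S) : Submodule ℝ (TangentSpace 𝓘(ℝ, E) θ) :=
  (orbitTangent p (θ : Params d m)).comap
    (mfderiv 𝓘(ℝ, E) 𝓘(ℝ, Params d m) (Subtype.val : S → Params d m) θ).toLinearMap

/-- The differential `DΦ_X(θ) : T_θ S → ℝ^n` of the realization map restricted to `S`. -/
def dRealization (σ : ℝ → ℝ) (X : Fin n → EuclideanSpace ℝ (Fin d)) (θ : S) :
    TangentSpace 𝓘(ℝ, E) θ →L[ℝ] EuclideanSpace ℝ (Fin n) :=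
  mfderiv 𝓘(ℝ, E) 𝓘(ℝ, EuclideanSpace ℝ (Fin n))
    (fun η : S => realization σ X (η : Params d m)) θ

/-- The pullback form `g_θ(u, v) = (1/n) ⟨DΦ_X(θ) u, DΦ_X(θ) v⟩` on `T_θ S`. -/
def pullbackForm (σ : ℝ → ℝ) (X : Fin n → EuclideanSpace ℝ (Fin d)) (θ : S) :
    TangentSpace 𝓘(ℝ, E) θ →L[ℝ] TangentSpace 𝓘(ℝ, E) θ →L[ℝ] ℝ :=
  (1 / (n : ℝ)) • pullbackInner (E := E) (dRealization E S σ X θ)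

lemma pullbackForm_apply (σ : ℝ → ℝ) (X : Fin n → EuclideanSpace ℝ (Fin d)) (θ : S)
    (u v : TangentSpace 𝓘(ℝ, E) θ) :
    pullbackForm E S σ X θ u v =
      1 / (n : ℝ) * inner ℝ (dRealization E S σ X θ u) (dRealization E S σ X θ v) := rfl

end Regular

/-- The orbit space `M = S / G`, with the quotient topology. -/
abbrev OrbitSpace {p : ℝ} {d m : ℕ} (S : SubMulAction (SymGroup p m) (Params d m)) : Type :=
  MulAction.orbitRel.Quotient (SymGroup p m) S

/-- The quotient map `q : S → M = S / G`. -/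
def quotientMap {p : ℝ} {d m : ℕ} (S : SubMulAction (SymGroup p m) (Params d m)) (θ : S) :
    OrbitSpace S :=
  Quotient.mk _ θ

/-- A family of subspaces `H_x ⊆ T_x M` is a smooth subbundle of the tangent bundle if every point
has an open neighbourhood on which `H` has a smooth frame. -/
def IsSmoothSubbundle {E M : Type*} [NormedAddCommGroup E] [NormedSpace ℝ E] [TopologicalSpace M]
    [ChartedSpace E M] [IsManifold 𝓘(ℝ, E) ∞ M]
    (H : ∀ x : M, Submodule ℝ (TangentSpace 𝓘(ℝ, E) x)) : Prop :=
  ∀ x₀ : M, ∃ (U : Set M) (r : ℕ) (Y : Fin r → ∀ x : M, TangentSpace 𝓘(ℝ, E) x),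
    IsOpen U ∧ x₀ ∈ U ∧
    (∀ i, ContMDiffOn 𝓘(ℝ, E) 𝓘(ℝ, E).tangent ∞
      (fun x => (⟨x, Y i x⟩ : TangentBundle 𝓘(ℝ, E) M)) U) ∧
    ∀ x ∈ U, LinearIndependent ℝ (fun i => Y i x) ∧
      Submodule.span ℝ (Set.range fun i => Y i x) = H x

end ShallowNet

end

/-! Homogeneity makes `Φ_X` invariant under `G`, so it descends to a map `Φ̄` on the orbit space
with `Φ_X = Φ̄ ∘ q`. Since `ker DΦ_X` is exactly the vertical space, `Φ̄` has injective
differential. The claims about `g` then become claims about the Euclidean inner product pulled back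
along `DΦ_X` or along `DΦ̄`.

The smooth structure on the orbit space comes from `Φ_X` itself. Discrete stabilizers give every
vertical space dimension `m` (`finrank_vertical`), so `DΦ_X` has constant rank `k = dim S - m`. Near
a point `θ₀`, some linear projection `h = P ∘ Φ_X` onto `ℝ^k` is invariant and has surjective
differential with vertical kernel at `θ₀`. A local section `s` of `h`, moved along the orbits by the
scalings `exp ξ`, sweeps out a neighbourhood of `θ₀` (`map_nhds_expScale_smul_section`). Hence `h`
separates the orbits that meet this neighbourhood and induces a chart with inverse `q ∘ s`
(`exists_quotient_chart`). Transition maps have the form `h' ∘ s`, hence are smooth. Properness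
yields the Hausdorff property.

The metric is `1/n` times the pullback of the inner product along `DΦ̄` (`quotientMetric`), the same
for every horizontal bundle. It is unique because `Dq` maps each horizontal space onto the tangent
space of the quotient. -/

noncomputable section

namespace ShallowNet

/-! ### Immersions, submersions and pulled-back forms -/

section Manifolds

variable {E : Type*} [NormedAddCommGroup E] [NormedSpace ℝ E]
  {E' : Type*} [NormedAddCommGroup E'] [NormedSpace ℝ E']
  {M : Type*} [TopologicalSpace M] [ChartedSpace E M]
  {N : Type*} [TopologicalSpace N] [ChartedSpace E' N]

/-- The differential of an immersion is injective. -/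
lemma mfderiv_injective_of_isImmersionAt [IsManifold 𝓘(ℝ, E) ∞ M] [IsManifold 𝓘(ℝ, E') ∞ N]
    {f : M → N} {x : M} (hf : Manifold.IsImmersionAt 𝓘(ℝ, E) 𝓘(ℝ, E') ∞ f x) :
    Function.Injective (mfderiv 𝓘(ℝ, E) 𝓘(ℝ, E') f x) := by
  -- In suitable charts an immersion is `u ↦ (u, 0)`. Forgetting the second component gives a smooth
  -- local left inverse `r`, and the chain rule turns `r ∘ f = id` into injectivity.
  let r : N → M := fun y => hf.domChart.symm (hf.equiv.symm (hf.codChart y)).1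
  have hrf : ∀ y ∈ hf.domChart.source, r (f y) = y := by
    intro y hy
    have h1 := hf.writtenInCharts (show hf.domChart y ∈ _ by
      simpa using hf.domChart.map_source hy)
    simp only [Function.comp_apply, OpenPartialHomeomorph.extend_coe, modelWithCornersSelf_coe,
      OpenPartialHomeomorph.extend_coe_symm, modelWithCornersSelf_coe_symm, id_eq,
      hf.domChart.left_inv hy] at h1
    simp only [r]
    rw [h1]
    simp [hf.domChart.left_inv hy]
  have hx := hf.mem_domChart_source
  have hr : ContMDiffAt 𝓘(ℝ, E') 𝓘(ℝ, E) ∞ r (f x) := by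
    have h1 := contMDiffAt_of_mem_maximalAtlas hf.codChart_mem_maximalAtlas hf.mem_codChart_source
    have h2 : ContMDiff 𝓘(ℝ, E') 𝓘(ℝ, E) ∞ (fun v : E' => (hf.equiv.symm v).1) := by
      rw [contMDiff_iff_contDiff]
      exact contDiff_fst.comp hf.equiv.symm.contDiff
    have h3 : (hf.equiv.symm (hf.codChart (f x))).1 = hf.domChart x := by
      have h1 := hf.writtenInCharts (show hf.domChart x ∈ _ by
        simpa using hf.domChart.map_source hx)
      simp only [Function.comp_apply, OpenPartialHomeomorph.extend_coe, modelWithCornersSelf_coe,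
        OpenPartialHomeomorph.extend_coe_symm, modelWithCornersSelf_coe_symm, id_eq,
        hf.domChart.left_inv hx] at h1
      rw [h1]
      simp
    have h4 : ContMDiffAt 𝓘(ℝ, E) 𝓘(ℝ, E) ∞ hf.domChart.symm
        (hf.equiv.symm (hf.codChart (f x))).1 := by
      rw [h3]
      exact contMDiffAt_symm_of_mem_maximalAtlas hf.domChart_mem_maximalAtlas
        (hf.domChart.map_source hx)
    exact h4.comp (f x) (h2.contMDiffAt.comp (f x) h1)
  have hid : r ∘ f =ᶠ[𝓝 x] id := by
    filter_upwards [hf.domChart.open_source.mem_nhds hx] with y hy using hrf y hy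
  have hcomp := mfderiv_comp x (hr.mdifferentiableAt (by simp))
    (hf.contMDiffAt.mdifferentiableAt (by simp))
  rw [hid.mfderiv_eq, mfderiv_id] at hcomp
  intro u v huv
  have := congrArg (mfderiv 𝓘(ℝ, E') 𝓘(ℝ, E) r (f x)) huv
  have key : ∀ w, mfderiv 𝓘(ℝ, E') 𝓘(ℝ, E) r (f x) (mfderiv 𝓘(ℝ, E) 𝓘(ℝ, E') f x w) = w :=
    fun w => (congrArg (fun L => L w) hcomp).symm
  exact (key u).symm.trans (this.trans (key v))

/-- A submersion has smooth local sections. -/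
lemma exists_localSection_of_isSubmersionAt [IsManifold 𝓘(ℝ, E) ∞ M]
    [IsManifold 𝓘(ℝ, E') ∞ N]
    {f : M → N} {x : M} (hf : Manifold.IsSubmersionAt 𝓘(ℝ, E) 𝓘(ℝ, E') ∞ f x) :
    ∃ s : N → M, s (f x) = x ∧ ContMDiffAt 𝓘(ℝ, E') 𝓘(ℝ, E) ∞ s (f x) ∧
      ∀ᶠ y in 𝓝 (f x), f (s y) = y := by
  have hx := hf.mem_domChart_source
  have hfx := hf.mem_codChart_source
  -- The fibre coordinate is frozen at its value at `x`, so that the section passes through `x`.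
  set c := (hf.equiv (hf.domChart x)).2 with hc
  have h0 : ∀ u ∈ hf.domChart.target,
      hf.codChart (f (hf.domChart.symm u)) = (hf.equiv u).1 := by
    intro u hu
    simpa using hf.writtenInCharts (show u ∈ _ by simpa using hu)
  have h3 : hf.equiv.symm (hf.codChart (f x), c) = hf.domChart x := by
    have := h0 _ (hf.domChart.map_source hx)
    rw [hf.domChart.left_inv hx] at this
    rw [this, hc]
    simp
  let ι : E' → E := fun v => hf.equiv.symm (v, c)
  let s : N → M := fun y => hf.domChart.symm (ι (hf.codChart y))
  have hι : ContMDiff 𝓘(ℝ, E') 𝓘(ℝ, E) ∞ ι := by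
    rw [contMDiff_iff_contDiff]
    exact hf.equiv.symm.contDiff.comp (contDiff_id.prodMk contDiff_const)
  have h1 : ContMDiffAt 𝓘(ℝ, E') 𝓘(ℝ, E) ∞ (fun y => ι (hf.codChart y)) (f x) :=
    hι.contMDiffAt.comp (f x)
      (contMDiffAt_of_mem_maximalAtlas hf.codChart_mem_maximalAtlas hfx)
  have h4 : ContMDiffAt 𝓘(ℝ, E) 𝓘(ℝ, E) ∞ hf.domChart.symm (ι (hf.codChart (f x))) := by
    simp only [ι]
    rw [h3]
    exact contMDiffAt_symm_of_mem_maximalAtlas hf.domChart_mem_maximalAtlas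
      (hf.domChart.map_source hx)
  refine ⟨s, ?_, h4.comp (f x) h1, ?_⟩
  · simp only [s, ι]
    rw [h3, hf.domChart.left_inv hx]
  · have h5 : ∀ᶠ y in 𝓝 (f x), ι (hf.codChart y) ∈ hf.domChart.target := by
      refine h1.continuousAt (hf.domChart.open_target.mem_nhds ?_)
      simp only [ι]
      rw [h3]
      exact hf.domChart.map_source hx
    filter_upwards [h5, hf.codChart.open_source.mem_nhds hfx] with y hy hy'
    have h6 := h0 _ hy
    have h7 : f (s y) ∈ hf.codChart.source :=
      hf.source_subset_preimage_source (hf.domChart.map_target hy)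
    refine hf.codChart.injOn h7 hy' ?_
    simp only [s]
    rw [h6]
    simp [ι]

/-- A map into a manifold whose differential at a point is surjective is open at that point. -/
lemma map_nhds_eq_of_surjective_mfderiv {V : Type*} [NormedAddCommGroup V] [NormedSpace ℝ V]
    [CompleteSpace V] [CompleteSpace E] [IsManifold 𝓘(ℝ, E) ∞ M] {f : V → M} {x : V}
    (hf : ContMDiffAt 𝓘(ℝ, V) 𝓘(ℝ, E) ∞ f x)
    (hsurj : Function.Surjective (mfderiv 𝓘(ℝ, V) 𝓘(ℝ, E) f x)) :
    Filter.map f (𝓝 x) = 𝓝 (f x) := by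
  have h1 := contMDiffAt_iff_target.1 hf |>.2
  have h2 : ContDiffAt ℝ ∞ (extChartAt 𝓘(ℝ, E) (f x) ∘ f) x := contMDiffAt_iff_contDiffAt.1 h1
  have h3 : mfderiv 𝓘(ℝ, V) 𝓘(ℝ, E) f x = fderiv ℝ (extChartAt 𝓘(ℝ, E) (f x) ∘ f) x := by
    refine (hf.mdifferentiableAt (by simp)).mfderiv.trans ?_
    simp [writtenInExtChartAt, chartAt_self_eq]
    rfl
  -- In the target chart the map goes between Banach spaces, where a strictly differentiable map
  -- with surjective derivative is open at the point.
  have h4 := h2.hasStrictFDerivAt (by simp)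
  have h5 : (fderiv ℝ (extChartAt 𝓘(ℝ, E) (f x) ∘ f) x).range = ⊤ := by
    rw [← h3]
    exact LinearMap.range_eq_top.2 hsurj
  have h6 := h4.map_nhds_eq_of_surj h5
  have hcont : f ⁻¹' (chartAt E (f x)).source ∈ 𝓝 x :=
    hf.continuousAt ((chartAt E (f x)).open_source.mem_nhds (mem_chart_source E (f x)))
  have h7 : Filter.map (chartAt E (f x)).symm (𝓝 (chartAt E (f x) (f x))) = 𝓝 (f x) :=
    (chartAt E (f x)).symm_map_nhds_eq (mem_chart_source E (f x))
  have h8 : f =ᶠ[𝓝 x] (chartAt E (f x)).symm ∘ (extChartAt 𝓘(ℝ, E) (f x) ∘ f) := by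
    filter_upwards [hcont] with y hy
    simp [(chartAt E (f x)).left_inv hy]
  rw [Filter.map_congr h8, ← Filter.map_map, h6]
  simpa using h7

/-- A smooth map whose differential at a point is surjective looks like a linear projection in
suitable charts. -/
lemma exists_chart_eq_fst [FiniteDimensional ℝ E] [IsManifold 𝓘(ℝ, E) ∞ M]
    {W F : Type*} [NormedAddCommGroup W] [NormedSpace ℝ W] [FiniteDimensional ℝ W]
    [NormedAddCommGroup F] [NormedSpace ℝ F] [FiniteDimensional ℝ F]
    (hdim : Module.finrank ℝ E = Module.finrank ℝ W + Module.finrank ℝ F)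
    {h : M → W} (hh : ContMDiff 𝓘(ℝ, E) 𝓘(ℝ, W) ∞ h) {x : M}
    (hsurj : Function.Surjective (mfderiv 𝓘(ℝ, E) 𝓘(ℝ, W) h x)) :
    ∃ (φ : OpenPartialHomeomorph M E) (e : E ≃L[ℝ] W × F),
      φ ∈ IsManifold.maximalAtlas 𝓘(ℝ, E) ∞ M ∧ x ∈ φ.source ∧
      ∀ u ∈ φ.target, h (φ.symm u) = (e u).1 := by
  set φ₀ := chartAt E x with hφ₀
  have hφ₀M : φ₀ ∈ IsManifold.maximalAtlas 𝓘(ℝ, E) ∞ M := IsManifold.chart_mem_maximalAtlas x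
  have hx0 : x ∈ φ₀.source := mem_chart_source E x
  set u₀ := φ₀ x
  have hu₀ : u₀ ∈ φ₀.target := φ₀.map_source hx0
  let f : E → W := h ∘ φ₀.symm
  have hf : ContDiffOn ℝ ∞ f φ₀.target := by
    rw [← contMDiffOn_iff_contDiffOn]
    exact hh.comp_contMDiffOn (contMDiffOn_symm_of_mem_maximalAtlas hφ₀M)
  have hfa : ∀ u ∈ φ₀.target, ContDiffAt ℝ ∞ f u := fun u hu =>
    hf.contDiffAt (φ₀.open_target.mem_nhds hu)
  let L : E →L[ℝ] W := fderiv ℝ f u₀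
  have hL : mfderiv 𝓘(ℝ, E) 𝓘(ℝ, W) h x = L := by
    refine (hh.mdifferentiableAt (by simp)).mfderiv.trans ?_
    simp only [writtenInExtChartAt, L, f, u₀]
    simp [hφ₀, Function.comp_def, chartAt_self_eq]
    rfl
  have hLs : L.range = ⊤ := by
    rw [← hL]
    exact LinearMap.range_eq_top.2 hsurj
  obtain ⟨P, hP⟩ := L.ker.exists_isCompl
  have hker : Module.finrank ℝ L.ker = Module.finrank ℝ F := by
    have h1 := LinearMap.finrank_range_add_finrank_ker (L : E →ₗ[ℝ] W)
    have h2 : Module.finrank ℝ (L : E →ₗ[ℝ] W).range = Module.finrank ℝ W := by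
      rw [show (L : E →ₗ[ℝ] W).range = ⊤ from hLs, finrank_top]
    have h3 : Module.finrank ℝ (L : E →ₗ[ℝ] W).ker = Module.finrank ℝ L.ker := rfl
    omega
  let κ : L.ker ≃L[ℝ] F := ContinuousLinearEquiv.ofFinrankEq hker
  let π : E →L[ℝ] F := κ.toContinuousLinearMap ∘L
    LinearMap.toContinuousLinearMap (Submodule.projectionOnto L.ker P hP)
  have hπr : π.range = ⊤ := by
    refine LinearMap.range_eq_top.2 ?_
    exact κ.surjective.comp (Submodule.projectionOnto_surjective hP)
  have hπk : π.ker = P := by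
    ext v
    simp only [π, LinearMap.mem_ker, ContinuousLinearMap.coe_coe, ContinuousLinearMap.comp_apply,
      ContinuousLinearEquiv.coe_coe, map_eq_zero_iff _ κ.injective]
    exact Submodule.projectionOnto_apply_eq_zero_iff hP
  let e : E ≃L[ℝ] W × F :=
    ContinuousLinearMap.equivProdOfSurjectiveOfIsCompl L π hLs hπr (hπk ▸ hP)
  have he : ∀ v, e v = (L v, π v) := fun v => rfl
  -- `G` replaces the linear part `L` in `e = (L, π)` by `f` itself. Its derivative at `u₀` is the
  -- identity, and in the coordinate `G` the map `f` becomes the first component of `e`.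
  let G : E → E := fun u => e.symm (f u, π u)
  have hGa : ∀ u ∈ φ₀.target, ContDiffAt ℝ ∞ G u := fun u hu =>
    e.symm.contDiff.contDiffAt.comp u ((hfa u hu).prodMk π.contDiff.contDiffAt)
  have hG0 : HasFDerivAt G ((ContinuousLinearEquiv.refl ℝ E : E ≃L[ℝ] E) : E →L[ℝ] E) u₀ := by
    have h1 : HasFDerivAt f L u₀ := ((hfa u₀ hu₀).differentiableAt (by simp)).hasFDerivAt
    have h2 := e.symm.toContinuousLinearMap.hasFDerivAt.comp u₀ (h1.prodMk π.hasFDerivAt)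
    convert! h2 using 1
    ext v
    simp [← he]
  let G' := (hGa u₀ hu₀).toOpenPartialHomeomorph G hG0 (by simp)
  have hG' : ∀ u, G' u = G u := fun u => rfl
  have hu₀G : u₀ ∈ G'.source :=
    (hGa u₀ hu₀).mem_toOpenPartialHomeomorph_source hG0 (by simp)
  have hGc : ContinuousOn (fderiv ℝ G) φ₀.target := by
    have : ContDiffOn ℝ ∞ G φ₀.target := fun u hu => (hGa u hu).contDiffWithinAt
    exact this.continuousOn_fderiv_of_isOpen φ₀.open_target (by simp)
  -- The inverse function theorem gives a smooth inverse only near one point. Restricting to the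
  -- open set where `DG` is invertible makes the inverse smooth on the whole chart target.
  let U : Set E := φ₀.target ∩ fderiv ℝ G ⁻¹' (Set.range ((↑) : (E ≃L[ℝ] E) → E →L[ℝ] E))
  have hU : IsOpen U := hGc.isOpen_inter_preimage φ₀.open_target ContinuousLinearEquiv.isOpen
  have hu₀U : u₀ ∈ U := ⟨hu₀, ContinuousLinearEquiv.refl ℝ E, hG0.fderiv.symm⟩
  let ψ := G'.restrOpen U hU
  let φ := φ₀.trans ψ
  have hψs : ψ.source = G'.source ∩ U := rfl
  have hψsymm : ∀ v ∈ ψ.target, ContDiffAt ℝ ∞ ψ.symm v := by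
    intro v hv
    have h1 : ψ.symm v ∈ U := (ψ.map_target hv).2
    obtain ⟨A, hA⟩ := h1.2
    refine ψ.contDiffAt_symm (f₀' := A) hv ?_ (hGa _ h1.1)
    rw [hA]
    exact ((hGa _ h1.1).differentiableAt (by simp)).hasFDerivAt
  refine ⟨φ, e, ?_, ?_, ?_⟩
  · refine OpenPartialHomeomorph.mem_maximalAtlas_of_contMDiffOn φ ?_ ?_
    · have h1 : ContMDiffOn 𝓘(ℝ, E) 𝓘(ℝ, E) ∞ G φ₀.target := by
        rw [contMDiffOn_iff_contDiffOn]
        exact fun u hu => (hGa u hu).contDiffWithinAt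
      have h2 := h1.comp (contMDiffOn_of_mem_maximalAtlas hφ₀M) fun y hy => φ₀.map_source hy
      exact h2.mono fun y hy => by
        simp only [φ, OpenPartialHomeomorph.trans_source] at hy
        exact hy.1
    · have h1 : ContMDiffOn 𝓘(ℝ, E) 𝓘(ℝ, E) ∞ ψ.symm ψ.target := by
        rw [contMDiffOn_iff_contDiffOn]
        exact fun v hv => (hψsymm v hv).contDiffWithinAt
      have h2 := (contMDiffOn_symm_of_mem_maximalAtlas hφ₀M).comp h1
        fun v hv => (ψ.map_target hv).2.1
      exact h2.mono fun y hy => by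
        simp only [φ, OpenPartialHomeomorph.trans_target] at hy
        exact hy.1
  · simp only [φ, OpenPartialHomeomorph.trans_source]
    exact ⟨hx0, hu₀G, hu₀U⟩
  · intro u hu
    have hu' : u ∈ ψ.target := by
      simp only [φ, OpenPartialHomeomorph.trans_target] at hu
      exact hu.1
    have h1 : G (ψ.symm u) = u := ψ.right_inv hu'
    have h2 : e u = (f (ψ.symm u), π (ψ.symm u)) := by
      conv_lhs => rw [← h1]
      simp [G]
    rw [h2]
    rfl

/-- The pullback of an inner product along the differential of a smooth map is a smooth family of
bilinear forms. -/
lemma contMDiff_pullbackInner_mfderiv [IsManifold 𝓘(ℝ, E) ∞ M]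
    {F : Type*} [NormedAddCommGroup F] [InnerProductSpace ℝ F] {f : M → F}
    (hf : ContMDiff 𝓘(ℝ, E) 𝓘(ℝ, F) ∞ f) (c : ℝ) :
    ContMDiff 𝓘(ℝ, E) (𝓘(ℝ, E).prod 𝓘(ℝ, E →L[ℝ] E →L[ℝ] ℝ)) ∞
      (fun x : M => Bundle.TotalSpace.mk' (E →L[ℝ] E →L[ℝ] ℝ)
        (E := fun x : M => TangentSpace 𝓘(ℝ, E) x →L[ℝ] TangentSpace 𝓘(ℝ, E) x →L[ℝ] ℝ)
        x (c • pullbackInner (E := E) (F := F) (mfderiv 𝓘(ℝ, E) 𝓘(ℝ, F) f x))) := by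
  intro x₀
  rw [contMDiffAt_hom_bundle]
  refine ⟨contMDiffAt_id, ?_⟩
  have h1 := (hf x₀).mfderiv_const (m := ∞) (by simp)
  set A : M → E →L[ℝ] F :=
    inTangentCoordinates 𝓘(ℝ, E) 𝓘(ℝ, F) id f (mfderiv 𝓘(ℝ, E) 𝓘(ℝ, F) f) x₀ with hA
  -- In tangent coordinates at `x₀` the form is a quadratic expression `Q` in the coordinate matrix
  -- `A` of the differential, and `A` is smooth near `x₀`.
  let Q : (E →L[ℝ] F) → E →L[ℝ] E →L[ℝ] ℝ := fun B => c • pullbackInner B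
  have hQ : ContDiff ℝ ∞ Q := by
    have h2 : Q = fun B : E →L[ℝ] F => c • ((ContinuousLinearMap.compL ℝ E F ℝ).flip B ∘L
        ((innerSL ℝ : F →L[ℝ] F →L[ℝ] ℝ) ∘L B)) := rfl
    rw [h2]
    fun_prop
  refine ((contMDiff_iff_contDiff.2 hQ).contMDiffAt.comp x₀ h1).congr_of_eventuallyEq ?_
  have hbase : ∀ᶠ x in 𝓝 x₀, x ∈ (trivializationAt E (TangentSpace 𝓘(ℝ, E)) x₀).baseSet :=
    (trivializationAt E (TangentSpace 𝓘(ℝ, E)) x₀).open_baseSet.mem_nhds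
      (FiberBundle.mem_baseSet_trivializationAt' x₀)
  filter_upwards [hbase] with x hx
  have hAx : ∀ v, A x v = mfderiv 𝓘(ℝ, E) 𝓘(ℝ, F) f x
      ((trivializationAt E (TangentSpace 𝓘(ℝ, E)) x₀).symm x v) := by
    intro v
    simp only [hA, inTangentCoordinates, ContinuousLinearMap.inCoordinates]
    rw [TangentBundle.continuousLinearMapAt_model_space]
    exact congrArg (mfderiv 𝓘(ℝ, E) 𝓘(ℝ, F) f x)
      ((trivializationAt E (TangentSpace 𝓘(ℝ, E)) x₀).symmL_apply (R := ℝ) hx v)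
  ext v w
  refine (inCoordinates_apply_eq₂ hx hx (Set.mem_univ _)).trans ?_
  have h3 : Q (A x) v w = c * inner ℝ (A x v) (A x w) := rfl
  rw [Function.comp_apply, h3, hAx, hAx]
  simp
  rfl

end Manifolds

/-! ### Invariance of the network and the infinitesimal action -/

/-- The factor `c ^ (-p)` on the outer weight cancels the `c ^ p` that homogeneity produces; the
permutation only reindexes the sum. -/
lemma network_smul {d m : ℕ} {p : ℝ} {σ : ℝ → ℝ} (hσ : IsPosHomogeneous p σ)
    (g : SymGroup p m) (θ : Params d m) (x : EuclideanSpace ℝ (Fin d)) :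
    network σ (g • θ) x = network σ θ x := by
  have h : ∀ i, ((g • θ) i).1 * σ (inner ℝ ((g • θ) i).2 x) =
      (θ (g.perm⁻¹ i)).1 * σ (inner ℝ (θ (g.perm⁻¹ i)).2 x) := by
    intro i
    have hc : 0 < (g.scale i : ℝ) := (g.scale i).2
    rw [SymGroup.smul_apply, inner_smul_left, RCLike.conj_to_real, hσ _ hc, Real.rpow_neg hc.le]
    field_simp
  rw [network, Finset.sum_congr rfl fun i _ => h i]
  exact Equiv.sum_comp g.perm⁻¹ fun j => (θ j).1 * σ (inner ℝ (θ j).2 x)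

lemma realization_smul {d m n : ℕ} {p : ℝ} {σ : ℝ → ℝ} (hσ : IsPosHomogeneous p σ)
    (X : Fin n → EuclideanSpace ℝ (Fin d)) (g : SymGroup p m) (θ : Params d m) :
    realization σ X (g • θ) = realization σ X θ := by
  simp only [realization, network_smul hσ]

lemma expScale_smul_apply {d m : ℕ} (p : ℝ) (ξ : Fin m → ℝ) (θ : Params d m) (i : Fin m) :
    (SymGroup.expScale p ξ • θ) i =
      (Real.exp (ξ i) ^ (-p) * (θ i).1, Real.exp (ξ i) • (θ i).2) := rfl

lemma expScale_zero (p : ℝ) (m : ℕ) : SymGroup.expScale p (0 : Fin m → ℝ) = 1 := by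
  have : (fun i : Fin m => (⟨Real.exp ((0 : Fin m → ℝ) i), Real.exp_pos _⟩ : {c : ℝ // 0 < c}))
      = 1 := by
    funext i
    exact Subtype.ext (by simp)
  rw [SymGroup.expScale, this]
  rfl

lemma continuous_expScale (p : ℝ) (m : ℕ) :
    Continuous (SymGroup.expScale p : (Fin m → ℝ) → SymGroup p m) := by
  have h1 : Continuous fun ξ : Fin m → ℝ => (SymGroup.expScale p ξ).scale := by
    refine continuous_pi fun i =>
      Continuous.subtype_mk (f := fun ξ : Fin m → ℝ => Real.exp (ξ i)) ?_ _
    fun_prop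
  refine continuous_iff_coinduced_le.2 (le_inf ?_ ?_)
  · exact coinduced_le_iff_le_induced.2 (by rw [induced_compose]; exact h1.le_induced)
  · exact coinduced_le_iff_le_induced.2
      (by rw [induced_compose]; exact (@continuous_const _ _ _ ⊥ 1).le_induced)

lemma contDiff_smul {d m : ℕ} {p : ℝ} (g : SymGroup p m) :
    ContDiff ℝ ∞ (fun θ : Params d m => g • θ) := by
  rw [contDiff_pi]
  intro i
  simp only [SymGroup.smul_apply]
  fun_prop

lemma contDiff_expScale_smul (d m : ℕ) (p : ℝ) :
    ContDiff ℝ ∞ (fun z : (Fin m → ℝ) × Params d m => SymGroup.expScale p z.1 • z.2) := by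
  rw [contDiff_pi]
  intro i
  have h : (fun z : (Fin m → ℝ) × Params d m => (SymGroup.expScale p z.1 • z.2) i) =
      fun z => (Real.exp (z.1 i * -p) * (z.2 i).1, Real.exp (z.1 i) • (z.2 i).2) := by
    funext z
    rw [expScale_smul_apply, Real.exp_mul]
  rw [h]
  fun_prop

lemma fderiv_expScale_smul {d m : ℕ} (p : ℝ) (θ : Params d m) (ξ : Fin m → ℝ) :
    fderiv ℝ (fun η : Fin m → ℝ => SymGroup.expScale p η • θ) 0 ξ = orbitDirection p θ ξ := by
  have h1 : ContDiff ℝ ∞ (fun η : Fin m → ℝ => SymGroup.expScale p η • θ) :=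
    (contDiff_expScale_smul d m p).comp (contDiff_id.prodMk contDiff_const)
  have h2 : HasDerivAt (fun t : ℝ => t • ξ) ξ 0 := by
    simpa using (hasDerivAt_id (0 : ℝ)).smul_const ξ
  have h3 : HasFDerivAt (fun η : Fin m → ℝ => SymGroup.expScale p η • θ)
      (fderiv ℝ (fun η : Fin m → ℝ => SymGroup.expScale p η • θ) 0) ((0 : ℝ) • ξ) := by
    rw [zero_smul]
    exact (h1.differentiable (by simp)).differentiableAt.hasFDerivAt
  have h4 := h3.comp_hasDerivAt 0 h2
  exact h4.unique (hasDerivAt_expScale_smul p θ ξ)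

/-- If the stabilizer of `θ` is discrete, the infinitesimal action at `θ` is injective. -/
lemma orbitDirection_injective {d m : ℕ} {p : ℝ}
    {S : SubMulAction (SymGroup p m) (Params d m)} {θ : S}
    (hfree : DiscreteTopology (MulAction.stabilizer (SymGroup p m) θ)) :
    Function.Injective (orbitDirection p (θ : Params d m)) := by
  rw [injective_iff_map_eq_zero]
  intro ξ hξ
  -- If `δ_ξ θ = 0`, then in each coordinate either the exponent or the weight vanishes, so the
  -- whole one-parameter group `exp(tξ)` fixes `θ`.
  have hstab : ∀ t : ℝ, SymGroup.expScale p (t • ξ) ∈ MulAction.stabilizer (SymGroup p m) θ := by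
    intro t
    rw [MulAction.mem_stabilizer_iff]
    refine Subtype.ext ?_
    rw [SubMulAction.val_smul]
    funext i
    have hi := congrFun hξ i
    have h1 : -p * ξ i * ((θ : Params d m) i).1 = 0 := congrArg Prod.fst hi
    have h2 : ξ i • ((θ : Params d m) i).2 = 0 := congrArg Prod.snd hi
    rw [expScale_smul_apply, ← Real.exp_mul]
    refine Prod.ext ?_ ?_
    · rcases mul_eq_zero.1 h1 with h | h
      · have : (t • ξ) i * -p = 0 := by
          simp only [Pi.smul_apply, smul_eq_mul]
          linear_combination t * h
        rw [this, Real.exp_zero, one_mul]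
      · simp [h]
    · rcases smul_eq_zero.1 h2 with h | h
      · simp [h]
      · simp [h]
  let c : ℝ → MulAction.stabilizer (SymGroup p m) θ := fun t => ⟨_, hstab t⟩
  have hc : Continuous c := Continuous.subtype_mk
    ((continuous_expScale p m).comp (continuous_id.smul continuous_const)) _
  -- A continuous curve from the connected line into a discrete stabilizer is constant.
  have h10 : c 1 = c 0 := PreconnectedSpace.constant inferInstance hc
  funext i
  have h := congrArg (fun g : MulAction.stabilizer (SymGroup p m) θ =>
    ((g : SymGroup p m).scale i : ℝ)) h10
  have h' : Real.exp ((1 : ℝ) • ξ i) = Real.exp ((0 : ℝ) • ξ i) := h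
  simpa using h'

/-! ### Orbits inside the invariant submanifold -/

section Submanifold

variable {p : ℝ} {d m n : ℕ} {E : Type*} [NormedAddCommGroup E] [NormedSpace ℝ E]
  {S : SubMulAction (SymGroup p m) (Params d m)} [ChartedSpace E S]

/-- Smoothness into an embedded submanifold can be tested after inclusion, where the action is an
explicit formula. -/
lemma contMDiff_smul_of_isSmoothEmbedding
    (hemb : Manifold.IsSmoothEmbedding 𝓘(ℝ, E) 𝓘(ℝ, Params d m) ∞ (Subtype.val : S → Params d m))
    (γ : SymGroup p m) : ContMDiff 𝓘(ℝ, E) 𝓘(ℝ, E) ∞ (fun η : S => γ • η) := by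
  have h : ContMDiff 𝓘(ℝ, E) 𝓘(ℝ, Params d m) ∞ (Subtype.val ∘ fun η : S => γ • η) :=
    (contMDiff_iff_contDiff.2 (contDiff_smul γ)).comp hemb.isImmersion.contMDiff
  rw [ContMDiff.iff_comp_isImmersion hemb.isImmersion]
  exact ⟨hemb.isEmbedding.continuous_iff.2 h.continuous, h⟩

lemma contMDiffAt_expScale_smul
    (hemb : Manifold.IsSmoothEmbedding 𝓘(ℝ, E) 𝓘(ℝ, Params d m) ∞ (Subtype.val : S → Params d m))
    {V : Type*} [NormedAddCommGroup V] [NormedSpace ℝ V] {ξ : V → Fin m → ℝ} {f : V → S} {z : V}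
    (hξ : ContDiffAt ℝ ∞ ξ z) (hf : ContMDiffAt 𝓘(ℝ, V) 𝓘(ℝ, E) ∞ f z) :
    ContMDiffAt 𝓘(ℝ, V) 𝓘(ℝ, E) ∞ (fun v => SymGroup.expScale p (ξ v) • f v) z := by
  have h1 : ContDiffAt ℝ ∞ (fun v => (f v : Params d m)) z :=
    contMDiffAt_iff_contDiffAt.1 (hemb.isImmersion.contMDiff.contMDiffAt.comp z hf)
  have h2 : ContMDiffAt 𝓘(ℝ, V) 𝓘(ℝ, Params d m) ∞
      (Subtype.val ∘ fun v => SymGroup.expScale p (ξ v) • f v) z :=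
    contMDiffAt_iff_contDiffAt.2
      ((contDiff_expScale_smul d m p).contDiffAt.comp z (hξ.prodMk h1))
  rw [ContMDiffAt.iff_comp_isImmersionAt (hemb.isImmersion.isImmersionAt _)]
  exact ⟨hemb.isEmbedding.continuousAt_iff.2 h2.continuousAt, h2⟩

/-- The local parametrization `ξ ↦ exp(ξ) • θ` of the orbit of `θ`, with values in `S`. -/
def orbitMap (θ : S) (ξ : Fin m → ℝ) : S := SymGroup.expScale p ξ • θ

lemma contMDiffAt_orbitMap
    (hemb : Manifold.IsSmoothEmbedding 𝓘(ℝ, E) 𝓘(ℝ, Params d m) ∞ (Subtype.val : S → Params d m))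
    (θ : S) : ContMDiffAt 𝓘(ℝ, Fin m → ℝ) 𝓘(ℝ, E) ∞ (orbitMap θ) 0 :=
  contMDiffAt_expScale_smul hemb contDiffAt_id contMDiffAt_const

lemma orbitMap_zero (θ : S) : orbitMap θ 0 = θ := by
  rw [orbitMap, expScale_zero, one_smul]

/-- The differential of the orbit parametrization at the identity. -/
def orbitDifferential (E : Type*) [NormedAddCommGroup E] [NormedSpace ℝ E]
    [ChartedSpace E S] (θ : S) : (Fin m → ℝ) →L[ℝ] E :=
  mfderiv 𝓘(ℝ, Fin m → ℝ) 𝓘(ℝ, E) (orbitMap θ) 0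

lemma mfderiv_comp_orbitMap
    (hemb : Manifold.IsSmoothEmbedding 𝓘(ℝ, E) 𝓘(ℝ, Params d m) ∞ (Subtype.val : S → Params d m))
    (θ : S) {E' N : Type*} [NormedAddCommGroup E'] [NormedSpace ℝ E'] [TopologicalSpace N]
    [ChartedSpace E' N] {f : S → N} (hf : MDifferentiableAt 𝓘(ℝ, E) 𝓘(ℝ, E') f θ)
    (ξ : Fin m → ℝ) :
    mfderiv 𝓘(ℝ, E) 𝓘(ℝ, E') f θ (orbitDifferential E θ ξ) =
      (mfderiv 𝓘(ℝ, Fin m → ℝ) 𝓘(ℝ, E') (f ∘ orbitMap θ) 0 : (Fin m → ℝ) →L[ℝ] E') ξ := by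
  have h1 : MDifferentiableAt 𝓘(ℝ, E) 𝓘(ℝ, E') f (orbitMap θ 0) := by rwa [orbitMap_zero]
  rw [mfderiv_comp 0 h1 ((contMDiffAt_orbitMap hemb θ).mdifferentiableAt (by simp))]
  -- `orbitMap θ 0` equals `θ` only propositionally, so the two differentials are compared as maps
  -- on the model space `E`.
  have h2 : ∀ η : S, η = θ → ∀ v : E,
      (mfderiv 𝓘(ℝ, E) 𝓘(ℝ, E') f θ : E →L[ℝ] E') v =
        (mfderiv 𝓘(ℝ, E) 𝓘(ℝ, E') f η : E →L[ℝ] E') v := by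
    rintro η rfl v
    rfl
  exact h2 _ (orbitMap_zero θ) _

/-- Identifies the intrinsic orbit velocity in `T_θ S` with the ambient formula; in particular all
orbit directions are tangent to `S`. -/
lemma mfderiv_val_orbitDifferential
    (hemb : Manifold.IsSmoothEmbedding 𝓘(ℝ, E) 𝓘(ℝ, Params d m) ∞ (Subtype.val : S → Params d m))
    (θ : S) (ξ : Fin m → ℝ) :
    mfderiv 𝓘(ℝ, E) 𝓘(ℝ, Params d m) (Subtype.val : S → Params d m) θ (orbitDifferential E θ ξ) =
      orbitDirection p (θ : Params d m) ξ := by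
  rw [mfderiv_comp_orbitMap hemb θ (hemb.isImmersion.contMDiff.mdifferentiableAt (by simp)),
    mfderiv_eq_fderiv]
  exact fderiv_expScale_smul p (θ : Params d m) ξ

variable [IsManifold 𝓘(ℝ, E) ∞ S]

/-- The vertical space is spanned by the velocities of the orbit. -/
lemma mem_vertical_iff
    (hemb : Manifold.IsSmoothEmbedding 𝓘(ℝ, E) 𝓘(ℝ, Params d m) ∞ (Subtype.val : S → Params d m))
    (θ : S) (u : TangentSpace 𝓘(ℝ, E) θ) :
    u ∈ vertical E S θ ↔ ∃ ξ, orbitDifferential E θ ξ = u := by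
  have hinj := mfderiv_injective_of_isImmersionAt (hemb.isImmersion.isImmersionAt θ)
  constructor
  · rintro ⟨ξ, hξ⟩
    exact ⟨ξ, hinj ((mfderiv_val_orbitDifferential hemb θ ξ).trans hξ)⟩
  · rintro ⟨ξ, rfl⟩
    exact ⟨ξ, (mfderiv_val_orbitDifferential hemb θ ξ).symm⟩

/-- Discreteness of the stabilizer makes the `m` scaling directions independent. This is what gives
the realization map constant rank. -/
lemma finrank_vertical
    (hemb : Manifold.IsSmoothEmbedding 𝓘(ℝ, E) 𝓘(ℝ, Params d m) ∞ (Subtype.val : S → Params d m))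
    {θ : S} (hfree : DiscreteTopology (MulAction.stabilizer (SymGroup p m) θ)) :
    Module.finrank ℝ (vertical E S θ) = m := by
  have hinj : Function.Injective (orbitDifferential E θ) := by
    intro ξ η h
    refine orbitDirection_injective hfree ?_
    rw [← mfderiv_val_orbitDifferential hemb, ← mfderiv_val_orbitDifferential hemb, h]
  have hrange : LinearMap.range (orbitDifferential E θ).toLinearMap = vertical E S θ := by
    ext u
    exact (mem_vertical_iff hemb θ u).symm
  have h := LinearMap.finrank_range_of_inj (f := (orbitDifferential E θ).toLinearMap) hinj
  rw [Module.finrank_fin_fun] at h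
  have h3 := congrArg (fun V : Submodule ℝ E => Module.finrank ℝ V) hrange
  exact h3.symm.trans h

end Submanifold

/-! ### Reduction to full rank and local sections -/

/-- A continuous linear map of rank `k` becomes surjective onto `ℝ^k`, with the same kernel, after
composition with a suitable linear map. -/
lemma exists_comp_surjective_ker_eq {E V : Type*} [NormedAddCommGroup E] [NormedSpace ℝ E]
    [NormedAddCommGroup V] [NormedSpace ℝ V] [FiniteDimensional ℝ V] (L : E →L[ℝ] V) {k : ℕ}
    (hk : Module.finrank ℝ L.range = k) :
    ∃ P : V →L[ℝ] EuclideanSpace ℝ (Fin k),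
      Function.Surjective (P ∘ L) ∧ ∀ v, P (L v) = 0 → L v = 0 := by
  obtain ⟨C, hC⟩ := L.range.exists_isCompl
  let κ : L.range ≃L[ℝ] EuclideanSpace ℝ (Fin k) :=
    ContinuousLinearEquiv.ofFinrankEq (by rw [hk, finrank_euclideanSpace_fin])
  let P : V →L[ℝ] EuclideanSpace ℝ (Fin k) := κ.toContinuousLinearMap ∘L
    LinearMap.toContinuousLinearMap (Submodule.projectionOnto L.range C hC)
  have hP : ∀ v, P (L v) = κ ⟨L v, v, rfl⟩ := by
    intro v
    exact congrArg κ (Submodule.projectionOnto_apply_left hC ⟨L v, v, rfl⟩)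
  refine ⟨P, ?_, ?_⟩
  · intro y
    obtain ⟨⟨_, v, rfl⟩, hv⟩ := κ.surjective y
    exact ⟨v, (hP v).trans hv⟩
  · intro v hv
    rw [hP, map_eq_zero_iff _ κ.injective] at hv
    exact congrArg Subtype.val hv

section Manifolds

variable {E : Type*} [NormedAddCommGroup E] [NormedSpace ℝ E]
  {M : Type*} [TopologicalSpace M] [ChartedSpace E M]

/-- A smooth map into a vector space with surjective differential at a point has a smooth section
on a neighbourhood of the value. -/
lemma exists_localSection_of_surjective_mfderiv [FiniteDimensional ℝ E] [IsManifold 𝓘(ℝ, E) ∞ M]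
    {W F : Type*} [NormedAddCommGroup W] [NormedSpace ℝ W] [FiniteDimensional ℝ W]
    [NormedAddCommGroup F] [NormedSpace ℝ F] [FiniteDimensional ℝ F]
    (hdim : Module.finrank ℝ E = Module.finrank ℝ W + Module.finrank ℝ F)
    {h : M → W} (hh : ContMDiff 𝓘(ℝ, E) 𝓘(ℝ, W) ∞ h) {x : M}
    (hsurj : Function.Surjective (mfderiv 𝓘(ℝ, E) 𝓘(ℝ, W) h x)) :
    ∃ (s : W → M) (B : Set W), IsOpen B ∧ h x ∈ B ∧ s (h x) = x ∧
      ContMDiffOn 𝓘(ℝ, W) 𝓘(ℝ, E) ∞ s B ∧ ∀ y ∈ B, h (s y) = y := by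
  obtain ⟨φ, e, hφ, hx, he⟩ := exists_chart_eq_fst (F := F) hdim hh hsurj
  let c : F := (e (φ x)).2
  let ι : W → E := fun y => e.symm (y, c)
  have hι : ContDiff ℝ ∞ ι := e.symm.contDiff.comp (contDiff_id.prodMk contDiff_const)
  have hιx : ι (h x) = φ x := by
    have h1 := he _ (φ.map_source hx)
    rw [φ.left_inv hx] at h1
    simp only [ι, c, h1]
    simp
  refine ⟨φ.symm ∘ ι, ι ⁻¹' φ.target, φ.open_target.preimage hι.continuous, ?_, ?_, ?_, ?_⟩
  · rw [Set.mem_preimage, hιx]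
    exact φ.map_source hx
  · rw [Function.comp_apply, hιx, φ.left_inv hx]
  · exact (contMDiffOn_symm_of_mem_maximalAtlas hφ).comp
      (contMDiff_iff_contDiff.2 hι).contMDiffOn subset_rfl
  · intro y hy
    rw [Function.comp_apply, he _ hy]
    simp [ι]

lemma mfderiv_comp_apply_of_hasFDerivAt {V V' : Type*} [NormedAddCommGroup V] [NormedSpace ℝ V]
    [NormedAddCommGroup V'] [NormedSpace ℝ V'] {f : V' → M} {ι : V → V'} {x : V} {A : V →L[ℝ] V'}
    (hι : HasFDerivAt ι A x) (hf : MDifferentiableAt 𝓘(ℝ, V') 𝓘(ℝ, E) f (ι x)) (v : V) :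
    (mfderiv 𝓘(ℝ, V) 𝓘(ℝ, E) (f ∘ ι) x : V →L[ℝ] E) v =
      (mfderiv 𝓘(ℝ, V') 𝓘(ℝ, E) f (ι x) : V' →L[ℝ] E) (A v) :=
  congrArg (fun B : V →L[ℝ] E => B v) (hf.hasMFDerivAt.comp x hι.hasMFDerivAt).mfderiv

end Manifolds

/-! ### Charts of the orbit space -/

section Charts

variable {p : ℝ} {d m n : ℕ} {E : Type*} [NormedAddCommGroup E] [NormedSpace ℝ E]
  {S : SubMulAction (SymGroup p m) (Params d m)} [ChartedSpace E S]

/-- Moving a section of `h` along the orbits fills a neighbourhood, if the kernel of the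
differential of `h` consists of vertical vectors. -/
lemma map_nhds_expScale_smul_section [FiniteDimensional ℝ E] [IsManifold 𝓘(ℝ, E) ∞ S]
    (hemb : Manifold.IsSmoothEmbedding 𝓘(ℝ, E) 𝓘(ℝ, Params d m) ∞ (Subtype.val : S → Params d m))
    {W : Type*} [NormedAddCommGroup W] [NormedSpace ℝ W] [FiniteDimensional ℝ W]
    {h : S → W} (hh : ContMDiff 𝓘(ℝ, E) 𝓘(ℝ, W) ∞ h) {s : W → S} {y₀ : W}
    (hs : ContMDiffAt 𝓘(ℝ, W) 𝓘(ℝ, E) ∞ s y₀) (hhs : ∀ᶠ y in 𝓝 y₀, h (s y) = y)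
    (hker : ∀ w, mfderiv 𝓘(ℝ, E) 𝓘(ℝ, W) h (s y₀) w = 0 → w ∈ vertical E S (s y₀)) :
    Filter.map (fun z : (Fin m → ℝ) × W => SymGroup.expScale p z.1 • s z.2) (𝓝 (0, y₀)) =
      𝓝 (s y₀) := by
  obtain ⟨F, hF⟩ : ∃ F : (Fin m → ℝ) × W → S, F = fun z => SymGroup.expScale p z.1 • s z.2 :=
    ⟨_, rfl⟩
  rw [← hF]
  have hF0 : F (0, y₀) = s y₀ := by simp only [hF, expScale_zero, one_smul]
  have hFs : ContMDiffAt 𝓘(ℝ, (Fin m → ℝ) × W) 𝓘(ℝ, E) ∞ F (0, y₀) := by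
    rw [hF]
    refine contMDiffAt_expScale_smul hemb contDiffAt_fst ?_
    have h1 : ContMDiffAt 𝓘(ℝ, (Fin m → ℝ) × W) 𝓘(ℝ, W) ∞
        (Prod.snd : (Fin m → ℝ) × W → W) (0, y₀) :=
      contMDiffAt_iff_contDiffAt.2 contDiffAt_snd
    exact ContMDiffAt.comp (0, y₀) (g := s) hs h1
  have hFd := hFs.mdifferentiableAt (by simp)
  let DF : (Fin m → ℝ) × W →L[ℝ] E := mfderiv 𝓘(ℝ, (Fin m → ℝ) × W) 𝓘(ℝ, E) F (0, y₀)
  let Ds : W →L[ℝ] E := mfderiv 𝓘(ℝ, W) 𝓘(ℝ, E) s y₀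
  let Dh : E →L[ℝ] W := mfderiv 𝓘(ℝ, E) 𝓘(ℝ, W) h (s y₀)
  have h1 : ∀ ξ, orbitDifferential E (s y₀) ξ = DF (ξ, 0) := by
    intro ξ
    have hι : HasFDerivAt (fun ξ : Fin m → ℝ => (ξ, y₀))
        (ContinuousLinearMap.inl ℝ (Fin m → ℝ) W) 0 := hasFDerivAt_prodMk_left 0 y₀
    have hFι : F ∘ (fun ξ : Fin m → ℝ => (ξ, y₀)) = orbitMap (s y₀) := by
      rw [hF]
      rfl
    have hc := mfderiv_comp_apply_of_hasFDerivAt hι hFd ξ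
    rw [hFι] at hc
    exact hc
  have h2 : ∀ y, Ds y = DF (0, y) := by
    intro y
    have hι : HasFDerivAt (fun y : W => ((0 : Fin m → ℝ), y))
        (ContinuousLinearMap.inr ℝ (Fin m → ℝ) W) y₀ := hasFDerivAt_prodMk_right 0 y₀
    have hFι : F ∘ (fun y : W => ((0 : Fin m → ℝ), y)) = s := by
      funext y
      simp only [hF, Function.comp_apply, expScale_zero, one_smul]
    have hc := mfderiv_comp_apply_of_hasFDerivAt hι hFd y
    rw [hFι] at hc
    exact hc
  have h3 : ∀ y, Dh (Ds y) = y := by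
    intro y
    have hc := mfderiv_comp y₀ (hh.mdifferentiableAt (by simp) : MDifferentiableAt _ _ h (s y₀))
      (hs.mdifferentiableAt (by simp))
    have hid : h ∘ s =ᶠ[𝓝 y₀] id := hhs
    rw [hid.mfderiv_eq, mfderiv_id] at hc
    exact (congrArg (fun A : W →L[ℝ] W => A y) hc).symm
  -- Each `w` splits as `Ds (Dh w)`, reached along the section, plus a remainder killed by `Dh`,
  -- hence vertical and reached along the orbit.
  have hsurj : Function.Surjective DF := by
    intro w
    have h4 : Dh (w - Ds (Dh w)) = 0 := by rw [map_sub, h3, sub_self]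
    obtain ⟨ξ, hξ⟩ := (mem_vertical_iff hemb _ _).1 (hker _ h4)
    refine ⟨(ξ, Dh w), ?_⟩
    have h5 : ((ξ, Dh w) : (Fin m → ℝ) × W) = (ξ, 0) + (0, Dh w) := by simp
    rw [h5, map_add, ← h1, ← h2, hξ]
    exact sub_add_cancel _ _
  have := map_nhds_eq_of_surjective_mfderiv hFs hsurj
  rwa [hF0] at this

/-- A smooth invariant map whose differential at `θ₀` is surjective, with vertical kernel, induces a
chart of the orbit space whose inverse lifts to a smooth map. -/
lemma exists_quotient_chart [FiniteDimensional ℝ E] [IsManifold 𝓘(ℝ, E) ∞ S]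
    [ContinuousConstSMul (SymGroup p m) S]
    (hemb : Manifold.IsSmoothEmbedding 𝓘(ℝ, E) 𝓘(ℝ, Params d m) ∞ (Subtype.val : S → Params d m))
    {W F : Type*} [NormedAddCommGroup W] [NormedSpace ℝ W] [FiniteDimensional ℝ W]
    [NormedAddCommGroup F] [NormedSpace ℝ F] [FiniteDimensional ℝ F]
    (hdim : Module.finrank ℝ E = Module.finrank ℝ W + Module.finrank ℝ F)
    {h : S → W} (hh : ContMDiff 𝓘(ℝ, E) 𝓘(ℝ, W) ∞ h)
    (hinv : ∀ (g : SymGroup p m) (θ : S), h (g • θ) = h θ) {θ₀ : S}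
    (hsurj : Function.Surjective (mfderiv 𝓘(ℝ, E) 𝓘(ℝ, W) h θ₀))
    (hker : ∀ w, mfderiv 𝓘(ℝ, E) 𝓘(ℝ, W) h θ₀ w = 0 → w ∈ vertical E S θ₀) :
    ∃ (e : OpenPartialHomeomorph (OrbitSpace S) W) (s : W → S),
      quotientMap S θ₀ ∈ e.source ∧ (∀ θ, e (quotientMap S θ) = h θ) ∧
      ContMDiffOn 𝓘(ℝ, W) 𝓘(ℝ, E) ∞ s e.target ∧
      ∀ y ∈ e.target, e.symm y = quotientMap S (s y) := by
  obtain ⟨s, B, hB, hy₀, hs₀, hs, hhs⟩ :=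
    exists_localSection_of_surjective_mfderiv (F := F) hdim hh hsurj
  have hBn : B ∈ 𝓝 (h θ₀) := hB.mem_nhds hy₀
  have hmap := map_nhds_expScale_smul_section hemb hh (hs.contMDiffAt hBn)
    (Filter.eventually_of_mem hBn hhs) (by rw [hs₀]; exact hker)
  rw [hs₀] at hmap
  have himg : (fun z : (Fin m → ℝ) × W => SymGroup.expScale p z.1 • s z.2) '' {z | z.2 ∈ B} ∈
      𝓝 θ₀ := by
    rw [← hmap]
    exact Filter.image_mem_map (continuous_snd.continuousAt.preimage_mem_nhds hBn)
  obtain ⟨U, hUsub, hU, hθU⟩ := mem_nhds_iff.1 himg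
  have hqinv : ∀ (g : SymGroup p m) (θ : S), quotientMap S (g • θ) = quotientMap S θ :=
    fun g θ => Quotient.sound ⟨g, rfl⟩
  -- A point of `U` is `exp(ξ) • s y`, and invariance forces `y = h θ`. So on `U` the value of `h`
  -- determines the orbit.
  have hUs : ∀ θ ∈ U, h θ ∈ B ∧ quotientMap S θ = quotientMap S (s (h θ)) := by
    intro θ hθ
    obtain ⟨⟨ξ, y⟩, hy, rfl⟩ := hUsub hθ
    have h1 : h (SymGroup.expScale p ξ • s y) = y := (hinv _ _).trans (hhs y hy)
    refine ⟨?_, ?_⟩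
    · simp only [h1]
      exact hy
    · simp only [h1, hqinv]
  have hqc : Continuous (quotientMap S) := continuous_quotient_mk'
  have hqo : IsOpenMap (quotientMap S) := isOpenMap_quotient_mk'_mul
  let hbar : OrbitSpace S → W := Quotient.lift h (by
    rintro a b ⟨g, rfl⟩
    exact hinv g b)
  have hbar_q : ∀ θ, hbar (quotientMap S θ) = h θ := fun θ => rfl
  have hbarc : Continuous hbar := hh.continuous.quotient_lift _
  let O : Set (OrbitSpace S) := quotientMap S '' U
  have hO : IsOpen O := hqo U hU
  have hOs : ∀ x ∈ O, hbar x ∈ B ∧ quotientMap S (s (hbar x)) = x := by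
    rintro _ ⟨θ, hθ, rfl⟩
    exact ⟨(hUs θ hθ).1, (hUs θ hθ).2.symm⟩
  have hsc : ContinuousOn (fun y => quotientMap S (s y)) B :=
    hqc.comp_continuousOn hs.continuousOn
  let e : OpenPartialHomeomorph (OrbitSpace S) W :=
    { toFun := hbar
      invFun := fun y => quotientMap S (s y)
      source := O
      target := B ∩ (fun y => quotientMap S (s y)) ⁻¹' O
      map_source' := fun x hx => ⟨(hOs x hx).1, by
        rw [Set.mem_preimage, (hOs x hx).2]
        exact hx⟩
      map_target' := fun y hy => hy.2
      left_inv' := fun x hx => (hOs x hx).2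
      right_inv' := fun y hy => (hbar_q _).trans (hhs y hy.1)
      open_source := hO
      open_target := hsc.isOpen_inter_preimage hB hO
      continuousOn_toFun := hbarc.continuousOn
      continuousOn_invFun := hsc.mono Set.inter_subset_left }
  exact ⟨e, s, ⟨θ₀, hθU, rfl⟩, hbar_q, hs.mono Set.inter_subset_left, fun y _ => rfl⟩

end Charts

/-! ### Positivity and invariance of the pullback form -/

/-- A positive definite form pulled back from an inner product has bounded unit balls. -/
lemma isVonNBounded_pullbackInner_lt_one {E F : Type*} [NormedAddCommGroup E] [NormedSpace ℝ E]
    [FiniteDimensional ℝ E] [NormedAddCommGroup F] [InnerProductSpace ℝ F] (A : E →L[ℝ] F)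
    (hA : Function.Injective A) {c : ℝ} (hc : ∀ v, v ≠ 0 → 0 < c * inner ℝ (A v) (A v)) :
    Bornology.IsVonNBounded ℝ {v : E | c * inner ℝ (A v) (A v) < 1} := by
  rw [NormedSpace.isVonNBounded_iff]
  -- The sign of `c` can be read off only from a nonzero vector, so the zero space is treated apart.
  rcases subsingleton_or_nontrivial E with hE | hE
  · exact Set.subsingleton_of_subsingleton.finite.isBounded
  obtain ⟨v₀, hv₀⟩ := exists_ne (0 : E)
  have hc0 : 0 < c := by
    by_contra h
    have h1 := hc v₀ hv₀
    have h2 : 0 ≤ inner ℝ (A v₀) (A v₀) := real_inner_self_nonneg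
    nlinarith
  obtain ⟨K, hK, hKA⟩ := A.toLinearMap.exists_antilipschitzWith (LinearMap.ker_eq_bot.2 hA)
  refine isBounded_iff_forall_norm_le.2 ⟨K * √(1 / c), fun v hv => ?_⟩
  have h1 : ‖v‖ ≤ K * ‖A v‖ := by
    simpa using hKA.le_mul_dist v 0
  have h2 : ‖A v‖ ≤ √(1 / c) := by
    refine Real.le_sqrt_of_sq_le ?_
    rw [le_div_iff₀ hc0, ← real_inner_self_eq_norm_sq, mul_comm]
    exact le_of_lt hv
  exact h1.trans (mul_le_mul_of_nonneg_left h2 K.2)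

section Form

variable {p : ℝ} {d m n : ℕ} {E : Type*} [NormedAddCommGroup E] [NormedSpace ℝ E]
  {S : SubMulAction (SymGroup p m) (Params d m)} [ChartedSpace E S]
  {σ : ℝ → ℝ} {X : Fin n → EuclideanSpace ℝ (Fin d)}

/-- For `n = 0` there is no nonzero `y`, so the convention `1 / 0 = 0` does no harm. -/
lemma one_div_mul_inner_self_pos (y : EuclideanSpace ℝ (Fin n)) (hy : y ≠ 0) :
    0 < 1 / (n : ℝ) * inner ℝ y y := by
  have hn : 0 < n := by
    rcases Nat.eq_zero_or_pos n with rfl | h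
    · exact absurd (Subsingleton.elim y 0) hy
    · exact h
  have hn' : (0 : ℝ) < n := by exact_mod_cast hn
  exact mul_pos (by positivity) (real_inner_self_pos.2 hy)

lemma pullbackForm_self_pos (θ : S) {u : TangentSpace 𝓘(ℝ, E) θ}
    (hu : dRealization E S σ X θ u ≠ 0) : 0 < pullbackForm E S σ X θ u u :=
  one_div_mul_inner_self_pos _ hu

lemma pullbackForm_comm (θ : S) (u v : TangentSpace 𝓘(ℝ, E) θ) :
    pullbackForm E S σ X θ u v = pullbackForm E S σ X θ v u := by
  rw [pullbackForm_apply, pullbackForm_apply, real_inner_comm]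

lemma realization_val_smul (hσ : IsPosHomogeneous p σ) (γ : SymGroup p m) (θ : S) :
    realization σ X ((γ • θ : S) : Params d m) = realization σ X (θ : Params d m) := by
  rw [SubMulAction.val_smul, realization_smul hσ]

/-- The chain rule applied to `Φ_X ∘ γ = Φ_X`. -/
lemma dRealization_mfderiv_smul (hσ : IsPosHomogeneous p σ)
    (hemb : Manifold.IsSmoothEmbedding 𝓘(ℝ, E) 𝓘(ℝ, Params d m) ∞ (Subtype.val : S → Params d m))
    (hsmooth : ContMDiff 𝓘(ℝ, E) 𝓘(ℝ, EuclideanSpace ℝ (Fin n)) ∞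
      (fun θ : S => realization σ X (θ : Params d m)))
    (γ : SymGroup p m) (θ : S) (u : TangentSpace 𝓘(ℝ, E) θ) :
    dRealization E S σ X (γ • θ) (mfderiv 𝓘(ℝ, E) 𝓘(ℝ, E) (fun η : S => γ • η) θ u) =
      dRealization E S σ X θ u := by
  have h1 := mfderiv_comp θ (g := fun η : S => realization σ X (η : Params d m))
    (f := fun η : S => γ • η) (hsmooth.mdifferentiableAt (by simp))
    ((contMDiff_smul_of_isSmoothEmbedding hemb γ).mdifferentiableAt (by simp))
  have h2 : (fun η : S => realization σ X (η : Params d m)) ∘ (fun η : S => γ • η) =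
      fun η : S => realization σ X (η : Params d m) :=
    funext fun η => realization_val_smul hσ γ η
  rw [h2] at h1
  exact (congrArg (fun A : E →L[ℝ] EuclideanSpace ℝ (Fin n) => A u) h1).symm

end Form

/-! ### Smooth structure and metric on the orbit space -/

section Quotient

variable {p : ℝ} {d m n : ℕ} {E : Type*} [NormedAddCommGroup E] [NormedSpace ℝ E]
  {S : SubMulAction (SymGroup p m) (Params d m)} [ChartedSpace E S] [IsManifold 𝓘(ℝ, E) ∞ S]
  {σ : ℝ → ℝ} {X : Fin n → EuclideanSpace ℝ (Fin d)}

/-- The orbit space is a smooth manifold, with charts induced by linear projections of the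
realization map. -/
lemma exists_isSubmersion_quotientMap [FiniteDimensional ℝ E] (hσ : IsPosHomogeneous p σ)
    (hemb : Manifold.IsSmoothEmbedding 𝓘(ℝ, E) 𝓘(ℝ, Params d m) ∞ (Subtype.val : S → Params d m))
    [ContinuousConstSMul (SymGroup p m) S]
    (hfree : ∀ θ : S, DiscreteTopology (MulAction.stabilizer (SymGroup p m) θ))
    (hsmooth : ContMDiff 𝓘(ℝ, E) 𝓘(ℝ, EuclideanSpace ℝ (Fin n)) ∞
      (fun θ : S => realization σ X (θ : Params d m)))
    (hker : ∀ θ : S, LinearMap.ker (dRealization E S σ X θ).toLinearMap = vertical E S θ) :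
    ∃ (k : ℕ) (_ : ChartedSpace (EuclideanSpace ℝ (Fin k)) (OrbitSpace S)),
      IsManifold (𝓡 k) ∞ (OrbitSpace S) ∧
        Manifold.IsSubmersion 𝓘(ℝ, E) (𝓡 k) ∞ (quotientMap S) := by
  -- The subtraction is truncated; `m ≤ dim E` is known only once `S` has a point. For empty `S`
  -- every choice of `k` works.
  let k := Module.finrank ℝ E - m
  let W := EuclideanSpace ℝ (Fin k)
  let L : S → E →L[ℝ] EuclideanSpace ℝ (Fin n) := fun θ => dRealization E S σ X θ
  have hrank : ∀ θ : S, Module.finrank ℝ E = k + m ∧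
      Module.finrank ℝ (LinearMap.range (L θ).toLinearMap) = k := by
    intro θ
    have h1 := LinearMap.finrank_range_add_finrank_ker (L θ).toLinearMap
    have h2 : Module.finrank ℝ (LinearMap.ker (L θ).toLinearMap) = m :=
      (congrArg (fun V : Submodule ℝ E => Module.finrank ℝ V) (hker θ)).trans
        (finrank_vertical hemb (hfree θ))
    rw [h2] at h1
    exact ⟨by omega, by omega⟩
  have hdim : ∀ θ : S, Module.finrank ℝ E =
      Module.finrank ℝ W + Module.finrank ℝ (EuclideanSpace ℝ (Fin m)) := by
    intro θ
    rw [finrank_euclideanSpace_fin, finrank_euclideanSpace_fin]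
    exact (hrank θ).1
  have hcharts : ∀ θ : S, ∃ (h : S → W) (e : OpenPartialHomeomorph (OrbitSpace S) W) (s : W → S),
      ContMDiff 𝓘(ℝ, E) 𝓘(ℝ, W) ∞ h ∧
      Function.Surjective (mfderiv 𝓘(ℝ, E) 𝓘(ℝ, W) h θ) ∧
      quotientMap S θ ∈ e.source ∧ (∀ η, e (quotientMap S η) = h η) ∧
      ContMDiffOn 𝓘(ℝ, W) 𝓘(ℝ, E) ∞ s e.target ∧
      ∀ y ∈ e.target, e.symm y = quotientMap S (s y) := by
    intro θ
    obtain ⟨P, hPs, hPk⟩ := exists_comp_surjective_ker_eq (L θ) (hrank θ).2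
    let h : S → W := fun η => P (realization σ X (η : Params d m))
    have hh : ContMDiff 𝓘(ℝ, E) 𝓘(ℝ, W) ∞ h :=
      (contMDiff_iff_contDiff.2 P.contDiff).comp hsmooth
    have hder : ∀ u : E, (mfderiv 𝓘(ℝ, E) 𝓘(ℝ, W) h θ : E →L[ℝ] W) u = P (L θ u) := by
      intro u
      have h1 := HasMFDerivAt.comp θ (P.hasFDerivAt
        (x := realization σ X (θ : Params d m))).hasMFDerivAt
        (hsmooth.mdifferentiableAt (by simp) (x := θ)).hasMFDerivAt
      exact congrArg (fun A : E →L[ℝ] W => A u) h1.mfderiv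
    have hhs : Function.Surjective (mfderiv 𝓘(ℝ, E) 𝓘(ℝ, W) h θ) := by
      intro y
      obtain ⟨u, hu⟩ := hPs y
      exact ⟨u, (hder u).trans hu⟩
    obtain ⟨e, s, h1, h2, h3, h4⟩ := exists_quotient_chart (F := EuclideanSpace ℝ (Fin m)) hemb
      (hdim θ) hh (fun g η => congrArg P (realization_val_smul hσ g η)) hhs (by
        intro w hw
        rw [← hker θ]
        exact hPk w ((hder w).symm.trans hw))
    exact ⟨h, e, s, hh, hhs, h1, h2, h3, h4⟩
  choose h e s hh hhs hmem heq hs hsymm using hcharts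
  have hout : ∀ x : OrbitSpace S, quotientMap S (Quotient.out x) = x := fun x => Quotient.out_eq x
  let cs : ChartedSpace W (OrbitSpace S) :=
    { atlas := Set.range e
      chartAt := fun x => e (Quotient.out x)
      mem_chart_source := fun x => by
        have h1 := hmem (Quotient.out x)
        rwa [hout] at h1
      chart_mem_atlas := fun x => ⟨_, rfl⟩ }
  have hman : IsManifold (𝓡 k) ∞ (OrbitSpace S) := by
    refine isManifold_of_contDiffOn _ _ _ ?_
    rintro _ _ ⟨θ, rfl⟩ ⟨θ', rfl⟩
    -- Transition maps lift to `S`: one inverse chart followed by another chart is `h θ' ∘ s θ`.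
    have h1 : ContDiffOn ℝ ∞ (h θ' ∘ s θ) (e θ).target :=
      contMDiffOn_iff_contDiffOn.1 ((hh θ').comp_contMDiffOn (hs θ))
    refine (h1.mono ?_).congr ?_
    · intro y hy
      simp at hy
      exact hy.1
    · intro y hy
      simp at hy
      simp [hsymm θ y hy.1, heq]
  refine ⟨k, cs, hman, ?_⟩
  refine Manifold.IsSubmersionOfComplement.isSubmersion (F := EuclideanSpace ℝ (Fin m)) ?_
  intro θ
  -- The chart `e θ` reads `q` as `h θ`, so straightening `h θ` on `S` puts `q` in the normal form
  -- of a submersion.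
  obtain ⟨φ, ε, hφ, hθ, hε⟩ :=
    exists_chart_eq_fst (F := EuclideanSpace ℝ (Fin m)) (hdim θ) (hh θ) (hhs θ)
  refine Manifold.IsSubmersionAtOfComplement.mk_of_continuousAt
    (continuous_quotient_mk' (s := MulAction.orbitRel (SymGroup p m) S)).continuousAt ε φ (e θ)
    hθ (hmem θ) hφ (IsManifold.subset_maximalAtlas ⟨θ, rfl⟩) ?_
  intro u hu
  have hu' : u ∈ φ.target := by simpa using hu
  have h2 : e θ (quotientMap S (φ.symm u)) = (ε u).1 := (heq θ _).trans (hε u hu')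
  simpa using h2

/-- The map induced by the realization map on the orbit space. -/
def quotientRealization (hσ : IsPosHomogeneous p σ) (X : Fin n → EuclideanSpace ℝ (Fin d))
    (S : SubMulAction (SymGroup p m) (Params d m)) : OrbitSpace S → EuclideanSpace ℝ (Fin n) :=
  Quotient.lift (fun θ : S => realization σ X (θ : Params d m)) (by
    rintro a b ⟨g, rfl⟩
    exact realization_val_smul hσ g b)

variable {k : ℕ} [ChartedSpace (EuclideanSpace ℝ (Fin k)) (OrbitSpace S)]

lemma mfderiv_quotientMap_of_mem_vertical
    (hemb : Manifold.IsSmoothEmbedding 𝓘(ℝ, E) 𝓘(ℝ, Params d m) ∞ (Subtype.val : S → Params d m))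
    (hq : Manifold.IsSubmersion 𝓘(ℝ, E) (𝓡 k) ∞ (quotientMap S)) {θ : S}
    {u : TangentSpace 𝓘(ℝ, E) θ} (hu : u ∈ vertical E S θ) :
    mfderiv 𝓘(ℝ, E) (𝓡 k) (quotientMap S) θ u = 0 := by
  obtain ⟨ξ, rfl⟩ := (mem_vertical_iff hemb θ u).1 hu
  rw [mfderiv_comp_orbitMap hemb θ (hq.contMDiff.mdifferentiableAt (by simp))]
  have h1 : quotientMap S ∘ orbitMap θ = fun _ => quotientMap S θ :=
    funext fun ξ => Quotient.sound ⟨_, rfl⟩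
  rw [h1, mfderiv_const]
  rfl

variable [IsManifold (𝓡 k) ∞ (OrbitSpace S)]

/-- Near each point the induced map is `Φ_X ∘ s` for a smooth local section `s` of `q`. -/
lemma contMDiff_quotientRealization (hσ : IsPosHomogeneous p σ)
    (hsmooth : ContMDiff 𝓘(ℝ, E) 𝓘(ℝ, EuclideanSpace ℝ (Fin n)) ∞
      (fun θ : S => realization σ X (θ : Params d m)))
    (hq : Manifold.IsSubmersion 𝓘(ℝ, E) (𝓡 k) ∞ (quotientMap S)) :
    ContMDiff (𝓡 k) 𝓘(ℝ, EuclideanSpace ℝ (Fin n)) ∞ (quotientRealization hσ X S) := by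
  intro x
  obtain ⟨θ, rfl⟩ : ∃ θ, quotientMap S θ = x := ⟨x.out, Quotient.out_eq x⟩
  obtain ⟨s, hsθ, hs, hqs⟩ := exists_localSection_of_isSubmersionAt (hq.isSubmersionAt θ)
  refine (ContMDiffAt.comp (quotientMap S θ) hsmooth.contMDiffAt hs).congr_of_eventuallyEq ?_
  filter_upwards [hqs] with y hy
  conv_lhs => rw [← hy]
  rfl

lemma mfderiv_quotientRealization (hσ : IsPosHomogeneous p σ)
    (hsmooth : ContMDiff 𝓘(ℝ, E) 𝓘(ℝ, EuclideanSpace ℝ (Fin n)) ∞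
      (fun θ : S => realization σ X (θ : Params d m)))
    (hq : Manifold.IsSubmersion 𝓘(ℝ, E) (𝓡 k) ∞ (quotientMap S))
    (θ : S) (u : TangentSpace 𝓘(ℝ, E) θ) :
    mfderiv (𝓡 k) 𝓘(ℝ, EuclideanSpace ℝ (Fin n)) (quotientRealization hσ X S) (quotientMap S θ)
      (mfderiv 𝓘(ℝ, E) (𝓡 k) (quotientMap S) θ u) = dRealization E S σ X θ u := by
  have h1 := mfderiv_comp θ
    ((contMDiff_quotientRealization (X := X) hσ hsmooth hq).mdifferentiableAt (by simp))
    (hq.contMDiff.mdifferentiableAt (by simp))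
  exact (congrArg (fun A : E →L[ℝ] EuclideanSpace ℝ (Fin n) => A u) h1).symm

lemma mfderiv_quotientMap_surjective
    (hq : Manifold.IsSubmersion 𝓘(ℝ, E) (𝓡 k) ∞ (quotientMap S)) (θ : S) :
    Function.Surjective (mfderiv 𝓘(ℝ, E) (𝓡 k) (quotientMap S) θ) := by
  obtain ⟨s, hsθ, hs, hqs⟩ := exists_localSection_of_isSubmersionAt (hq.isSubmersionAt θ)
  intro y
  have h1 := mfderiv_comp (quotientMap S θ) (g := quotientMap S) (f := s)
    (hq.contMDiff.mdifferentiableAt (by simp)) (hs.mdifferentiableAt (by simp))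
  have hid : quotientMap S ∘ s =ᶠ[𝓝 (quotientMap S θ)] id := hqs
  rw [hid.mfderiv_eq, mfderiv_id] at h1
  have h2 : ∀ η : S, η = θ →
      ∀ v : E, (mfderiv 𝓘(ℝ, E) (𝓡 k) (quotientMap S) η : E →L[ℝ] EuclideanSpace ℝ (Fin k)) v =
        (mfderiv 𝓘(ℝ, E) (𝓡 k) (quotientMap S) θ : E →L[ℝ] EuclideanSpace ℝ (Fin k)) v := by
    rintro η rfl v
    rfl
  refine ⟨(mfderiv (𝓡 k) 𝓘(ℝ, E) s (quotientMap S θ) :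
    EuclideanSpace ℝ (Fin k) →L[ℝ] E) y, ?_⟩
  exact (h2 _ hsθ _).symm.trans (congrArg (fun A : EuclideanSpace ℝ (Fin k) →L[ℝ]
    EuclideanSpace ℝ (Fin k) => A y) h1).symm

/-- A vector killed by `DΦ̄` lifts to some `u` with `DΦ_X u = 0`; then `u` is vertical, and `Dq`
kills it. -/
lemma mfderiv_quotientRealization_injective (hσ : IsPosHomogeneous p σ)
    (hemb : Manifold.IsSmoothEmbedding 𝓘(ℝ, E) 𝓘(ℝ, Params d m) ∞ (Subtype.val : S → Params d m))
    (hsmooth : ContMDiff 𝓘(ℝ, E) 𝓘(ℝ, EuclideanSpace ℝ (Fin n)) ∞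
      (fun θ : S => realization σ X (θ : Params d m)))
    (hker : ∀ θ : S, LinearMap.ker (dRealization E S σ X θ).toLinearMap = vertical E S θ)
    (hq : Manifold.IsSubmersion 𝓘(ℝ, E) (𝓡 k) ∞ (quotientMap S)) (x : OrbitSpace S) :
    Function.Injective
      (mfderiv (𝓡 k) 𝓘(ℝ, EuclideanSpace ℝ (Fin n)) (quotientRealization hσ X S) x) := by
  obtain ⟨θ, rfl⟩ : ∃ θ, quotientMap S θ = x := ⟨x.out, Quotient.out_eq x⟩
  rw [injective_iff_map_eq_zero]
  intro y hy
  obtain ⟨u, rfl⟩ := mfderiv_quotientMap_surjective hq θ y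
  rw [mfderiv_quotientRealization hσ hsmooth hq] at hy
  refine mfderiv_quotientMap_of_mem_vertical hemb hq ?_
  rw [← hker θ]
  exact hy

/-- The Riemannian metric on the orbit space induced by the realization map. -/
def quotientMetric (hσ : IsPosHomogeneous p σ)
    (hemb : Manifold.IsSmoothEmbedding 𝓘(ℝ, E) 𝓘(ℝ, Params d m) ∞ (Subtype.val : S → Params d m))
    (hsmooth : ContMDiff 𝓘(ℝ, E) 𝓘(ℝ, EuclideanSpace ℝ (Fin n)) ∞
      (fun θ : S => realization σ X (θ : Params d m)))
    (hker : ∀ θ : S, LinearMap.ker (dRealization E S σ X θ).toLinearMap = vertical E S θ)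
    (hq : Manifold.IsSubmersion 𝓘(ℝ, E) (𝓡 k) ∞ (quotientMap S)) :
    Bundle.ContMDiffRiemannianMetric (𝓡 k) ∞ (EuclideanSpace ℝ (Fin k))
      (fun x : OrbitSpace S => TangentSpace (𝓡 k) x) where
  inner x := (1 / (n : ℝ)) • pullbackInner (E := EuclideanSpace ℝ (Fin k))
    (F := EuclideanSpace ℝ (Fin n))
    (mfderiv (𝓡 k) 𝓘(ℝ, EuclideanSpace ℝ (Fin n)) (quotientRealization hσ X S) x)
  symm x v w := congrArg (1 / (n : ℝ) * ·) (real_inner_comm (F := EuclideanSpace ℝ (Fin n)) _ _)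
  pos x v hv := one_div_mul_inner_self_pos _ fun h => hv
    (mfderiv_quotientRealization_injective hσ hemb hsmooth hker hq x (h.trans (map_zero _).symm))
  isVonNBounded x := by
    have hinj := mfderiv_quotientRealization_injective hσ hemb hsmooth hker hq x
    exact isVonNBounded_pullbackInner_lt_one (E := EuclideanSpace ℝ (Fin k))
      (F := EuclideanSpace ℝ (Fin n)) _ hinj fun v hv =>
        one_div_mul_inner_self_pos _ fun h => hv (hinj (h.trans (map_zero _).symm))
  contMDiff := contMDiff_pullbackInner_mfderiv (contMDiff_quotientRealization hσ hsmooth hq) _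

end Quotient

end ShallowNet

end

/-! ### The quotient metric theorem -/

theorem mainTheorem2 {d m n : ℕ} {p : ℝ} (hp : 0 < p) (σ : ℝ → ℝ)
    (hσ : ShallowNet.IsPosHomogeneous p σ) (X : Fin n → EuclideanSpace ℝ (Fin d))
    {E : Type*} [NormedAddCommGroup E] [NormedSpace ℝ E] [FiniteDimensional ℝ E]
    -- the regular set: a `G`-invariant embedded submanifold of the parameter space
    (S : SubMulAction (ShallowNet.SymGroup p m) (ShallowNet.Params d m))
    [ChartedSpace E S] [IsManifold 𝓘(ℝ, E) ∞ S]
    (hemb : Manifold.IsSmoothEmbedding 𝓘(ℝ, E) 𝓘(ℝ, ShallowNet.Params d m) ∞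
      (Subtype.val : S → ShallowNet.Params d m))
    -- the action is proper and locally free on it
    (hproper : ProperSMul (ShallowNet.SymGroup p m) S)
    (hfree : ∀ θ : S, DiscreteTopology (MulAction.stabilizer (ShallowNet.SymGroup p m) θ))
    -- the realization map is smooth on it, with kernel the orbit directions
    (hsmooth : ContMDiff 𝓘(ℝ, E) 𝓘(ℝ, EuclideanSpace ℝ (Fin n)) ∞
      (fun θ : S => ShallowNet.realization σ X (θ : ShallowNet.Params d m)))
    (hker : ∀ θ : S, LinearMap.ker (ShallowNet.dRealization E S σ X θ).toLinearMap =
      ShallowNet.vertical E S θ) :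
    -- the pullback form is smooth, symmetric and `G`-invariant
    (ContMDiff 𝓘(ℝ, E) (𝓘(ℝ, E).prod 𝓘(ℝ, E →L[ℝ] E →L[ℝ] ℝ)) ∞
        (fun θ : S => Bundle.TotalSpace.mk' (E →L[ℝ] E →L[ℝ] ℝ)
          (E := fun θ : S => TangentSpace 𝓘(ℝ, E) θ →L[ℝ] TangentSpace 𝓘(ℝ, E) θ →L[ℝ] ℝ)
          θ (ShallowNet.pullbackForm E S σ X θ)) ∧
      (∀ (θ : S) (u v : TangentSpace 𝓘(ℝ, E) θ),
        ShallowNet.pullbackForm E S σ X θ u v = ShallowNet.pullbackForm E S σ X θ v u) ∧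
      (∀ (γ : ShallowNet.SymGroup p m) (θ : S) (u v : TangentSpace 𝓘(ℝ, E) θ),
        ShallowNet.pullbackForm E S σ X (γ • θ)
            (mfderiv 𝓘(ℝ, E) 𝓘(ℝ, E) (fun η : S => γ • η) θ u)
            (mfderiv 𝓘(ℝ, E) 𝓘(ℝ, E) (fun η : S => γ • η) θ v) =
          ShallowNet.pullbackForm E S σ X θ u v)) ∧
    -- its radical is the vertical space
    (∀ (θ : S) (u : TangentSpace 𝓘(ℝ, E) θ),
      (∀ v : TangentSpace 𝓘(ℝ, E) θ, ShallowNet.pullbackForm E S σ X θ u v = 0) ↔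
        u ∈ ShallowNet.vertical E S θ) ∧
    -- it is positive definite on every complement of the vertical space
    (∀ (θ : S) (W : Submodule ℝ (TangentSpace 𝓘(ℝ, E) θ)), IsCompl (ShallowNet.vertical E S θ) W →
      ∀ u ∈ W, u ≠ 0 → 0 < ShallowNet.pullbackForm E S σ X θ u u) ∧
    -- the orbit space is a smooth manifold for which the quotient map is a smooth submersion
    (T2Space (ShallowNet.OrbitSpace S) ∧
      SecondCountableTopology (ShallowNet.OrbitSpace S) ∧
      ∃ (k : ℕ) (_ : ChartedSpace (EuclideanSpace ℝ (Fin k))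
          (ShallowNet.OrbitSpace S)),
        IsManifold (𝓡 k) ∞ (ShallowNet.OrbitSpace S) ∧
        Manifold.IsSubmersion 𝓘(ℝ, E) (𝓡 k) ∞
          (ShallowNet.quotientMap S)) ∧
    -- for every such structure and every smooth equivariant horizontal bundle, the form descends
    -- to a unique Riemannian metric
    (∀ (k : ℕ) [ChartedSpace (EuclideanSpace ℝ (Fin k))
          (ShallowNet.OrbitSpace S)]
        [IsManifold (𝓡 k) ∞ (ShallowNet.OrbitSpace S)],
      Manifold.IsSubmersion 𝓘(ℝ, E) (𝓡 k) ∞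
          (ShallowNet.quotientMap S) →
      ∀ H : ∀ θ : S, Submodule ℝ (TangentSpace 𝓘(ℝ, E) θ),
        ShallowNet.IsSmoothSubbundle H →
        (∀ θ : S, IsCompl (ShallowNet.vertical E S θ) (H θ)) →
        (∀ (γ : ShallowNet.SymGroup p m) (θ : S),
          (H θ).map (mfderiv 𝓘(ℝ, E) 𝓘(ℝ, E) (fun η : S => γ • η) θ).toLinearMap = H (γ • θ)) →
        ∃! gbar : Bundle.ContMDiffRiemannianMetric (𝓡 k) ∞ (EuclideanSpace ℝ (Fin k))
            (fun x : ShallowNet.OrbitSpace S =>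
              TangentSpace (𝓡 k) x),
          ∀ (θ : S), ∀ u ∈ H θ, ∀ v ∈ H θ,
            gbar.inner (ShallowNet.quotientMap S θ)
                (mfderiv 𝓘(ℝ, E) (𝓡 k) (ShallowNet.quotientMap S) θ u)
                (mfderiv 𝓘(ℝ, E) (𝓡 k) (ShallowNet.quotientMap S) θ v) =
              ShallowNet.pullbackForm E S σ X θ u v) := by
  have hsmul : ContinuousConstSMul (ShallowNet.SymGroup p m) S := inferInstance
  refine ⟨⟨?_, ?_, ?_⟩, ?_, ?_, ⟨?_, ?_, ?_⟩, ?_⟩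
  · exact ShallowNet.contMDiff_pullbackInner_mfderiv hsmooth _
  · exact fun θ u v => ShallowNet.pullbackForm_comm θ u v
  · intro γ θ u v
    rw [ShallowNet.pullbackForm_apply, ShallowNet.pullbackForm_apply,
      ShallowNet.dRealization_mfderiv_smul hσ hemb hsmooth,
      ShallowNet.dRealization_mfderiv_smul hσ hemb hsmooth]
  · intro θ u
    rw [← hker θ]
    constructor
    -- The test vector `v = u` suffices, as `g(u, u) > 0` unless `DΦ_X u = 0`.
    · intro h
      by_contra hu
      exact (ShallowNet.pullbackForm_self_pos θ hu).ne' (h u)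
    · intro h v
      have h' : ShallowNet.dRealization E S σ X θ u = 0 := h
      rw [ShallowNet.pullbackForm_apply, h', inner_zero_left, mul_zero]
  · intro θ W hW u hu hu0
    refine ShallowNet.pullbackForm_self_pos θ fun h => hu0 ?_
    have hv : u ∈ ShallowNet.vertical E S θ := by
      rw [← hker θ]
      exact h
    exact (Submodule.disjoint_def.1 hW.disjoint) u hv hu
  · exact t2Space_quotient_mulAction_of_properSMul
  · exact ContinuousConstSMul.secondCountableTopology
  · exact ShallowNet.exists_isSubmersion_quotientMap hσ hemb hfree hsmooth hker
  · intro k _ _ hq H _ hcompl _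
    refine ⟨ShallowNet.quotientMetric hσ hemb hsmooth hker hq, ?_, ?_⟩
    · intro θ u _ v _
      rw [ShallowNet.pullbackForm_apply,
        ← ShallowNet.mfderiv_quotientRealization hσ hsmooth hq θ u,
        ← ShallowNet.mfderiv_quotientRealization hσ hsmooth hq θ v]
      rfl
    · intro g hg
      -- The vertical part of any lift is killed by `Dq`, so its horizontal part is again a lift.
      have hlift : ∀ (θ : S) (y : TangentSpace (𝓡 k) (ShallowNet.quotientMap S θ)),
          ∃ u ∈ H θ, mfderiv 𝓘(ℝ, E) (𝓡 k) (ShallowNet.quotientMap S) θ u = y := by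
        intro θ y
        obtain ⟨w, rfl⟩ := ShallowNet.mfderiv_quotientMap_surjective hq θ y
        obtain ⟨v, hv, u, hu, rfl⟩ := Submodule.mem_sup.1
          ((hcompl θ).sup_eq_top ▸ Submodule.mem_top : w ∈ ShallowNet.vertical E S θ ⊔ H θ)
        refine ⟨u, hu, ?_⟩
        rw [map_add, ShallowNet.mfderiv_quotientMap_of_mem_vertical hemb hq hv, zero_add]
      have hinner : g.inner = (ShallowNet.quotientMetric hσ hemb hsmooth hker hq).inner := by
        funext x
        obtain ⟨θ, rfl⟩ : ∃ θ, ShallowNet.quotientMap S θ = x := ⟨x.out, Quotient.out_eq x⟩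
        ext y z
        obtain ⟨u, hu, rfl⟩ := hlift θ y
        obtain ⟨v, hv, rfl⟩ := hlift θ z
        rw [hg θ u hu v hv, ShallowNet.pullbackForm_apply,
          ← ShallowNet.mfderiv_quotientRealization hσ hsmooth hq θ u,
          ← ShallowNet.mfderiv_quotientRealization hσ hsmooth hq θ v]
        rfl
      -- All other fields of a metric are proofs, so equality of the inner products suffices.
      cases g
      cases hinner
      rfl
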